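/- Let $S\subset\mathbb C$ be a set and $D:=\mathbb C\setminus S$, let $\tilde W_\pm:D\to\mathbb C$ be arbitrary functions, and put $W_\pm(\omega):=\omega^2\tilde W_\pm(\omega)$. For $x=(x_1,x_2)\in\mathbb R^2$ let $\tilde W(x_1,\omega):=\tilde W_+(\omega)$ if $x_1>0$ and $\tilde W(x_1,\omega):=\tilde W_-(\omega)$ if $x_1<0$, and let $W(x_1,\omega):=\omega^2\tilde W(x_1,\omega)$. Let $$\Omega_0:=\{\omega\in D: W_+(\omega)=0\ \text{or}\ W_-(\omega)=0\}.$$ With $\nabla:=(\partial_{x_1},\partial_{x_2},0)^T$ and all derivatives in the sense of distributions, let $H:=L^2(\mathbb R^2,\mathbb C^3)$, let $\mathcal R:=\{r\in H:\nabla\cdot r=0\}$ with the $L^2$ inner product, and for $\omega\in D$ let $$\mathcal D_\omega:=\{E\in H:\ \nabla\times E\in H,\ \nabla\times\nabla\times E\in H,\ \nabla\cdot(\tilde W(\cdot,\omega)E)=0\}.$$ Consider the pencil $\mathcal L$ given by $L(\omega;\lambda):=A(\omega)-\lambda B(\omega):\mathcal D_\omega\to\mathcal R$, $\omega\in D$,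 $\lambda\in\mathbb C$, where $A(\omega)E:=\nabla\times\nabla\times E$ and $B(\omega)E:=W(\cdot,\omega)E$, and write $L(\omega):=L(\omega;1)$. The parts of its spectrum are the following subsets of $D$. * The resolvent set consists of the $\omega\in D$ for which $L(\omega):\mathcal D_\omega\to\mathcal R$ is bijective with bounded inverse $\mathcal R\to H$; the spectrum $\sigma(\mathcal L)$ is its complement in $D$. * $\omega$ is an eigenvalue if $L(\omega)$ has a non-trivial kernel. It belongs to $\sigma_p^{(\infty)}(\mathcal L)$ (infinite algebraic multiplicity) if moreover $\dim\ker L(\omega)=\infty$ or there is a linearly independent sequence $(u_k)_{k\ge 0}$ in $\mathcal D_\omega$ with $u_0\in\ker L(\omega)\setminus\{0\}$ and $L(\omega)u_{k+1}=B(\omega)u_k$ for all $k\ge 0$; otherwise the eigenvalue belongs to $\sigma_p^{(<\infty)}(\mathcal L)$. * $\sigma_{\rm Weyl}(\mathcal L)$ consists of the $\omega$ for which there is a sequence $(u^{(n)})$ in $\mathcal D_\omega$ with $\|u^{(n)}\|_H=1$, $u^{(n)}\rightharpoonup 0$ in $H$ and $\|L(\omega)u^{(n)}\|_{\mathcal R}\to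 0$. * An operator is semi-Fredholm if its range is closed and its kernel or its cokernel is finite-dimensional, and Fredholm if its range is closed and both are finite-dimensional. Then $\omega\in\sigma_{e,1}(\mathcal L)$ if $L(\omega)$ is not semi-Fredholm; $\omega\in\sigma_{e,2}(\mathcal L)$ if $L(\omega)$ is not semi-Fredholm with finite-dimensional kernel; $\omega\in\sigma_{e,3}(\mathcal L)$ if $L(\omega)$ is not Fredholm; $\omega\in\sigma_{e,4}(\mathcal L)$ if $L(\omega)$ is not Fredholm of index $0$; and $\omega\in\sigma_{e,5}(\mathcal L)$ if $1$ does not lie in any connected component of $\{\lambda\in\mathbb C: L(\omega;\lambda)\text{ is semi-Fredholm}\}$ that contains a $\lambda$ for which $L(\omega;\lambda):\mathcal D_\omega\to\mathcal R$ is bijective with bounded inverse. **Theorem.** $$\sigma(\mathcal L)\cap\Omega_0=\Omega_0,$$ $$\sigma_p^{(<\infty)}(\mathcal L)\cap\Omega_0=\emptyset,$$ $$\sigma_p^{(\infty)}(\mathcal L)\cap\Omega_0=\{\omega\in\Omega_0:\ \tilde W_+(\omega)=0\ \text{or}\ \tilde W_-(\omega)=0\ \text{or}\ \tilde W_+(\omega)+\tilde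 W_-(\omega)=0\},$$ $$\sigma_{e,j}(\mathcal L)\cap\Omega_0=\sigma_{\rm Weyl}(\mathcal L)\cap\Omega_0=\Omega_0,\qquad j=1,\dots,5.$$ -/

import Mathlib

open MeasureTheory Filter Topology
open scoped ENNReal

noncomputable section

/-! ### Operator pencils `P(ω; lam) = A(ω) - lam * B(ω)` -/

/-- A family of (in general unbounded) operators `A(ω), B(ω) : H ⊇ dom ω → R`, indexed by the
spectral parameter `ω` ranging over `Ω`. -/
structure OperatorPencil (Ω H R : Type*)
    [NormedAddCommGroup H] [InnerProductSpace ℂ H]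
    [NormedAddCommGroup R] [InnerProductSpace ℂ R] where
  dom : Ω → Submodule ℂ H
  A : ∀ ω, dom ω →ₗ[ℂ] R
  B : ∀ ω, dom ω →ₗ[ℂ] R

section Operators

variable {H R : Type*} [NormedAddCommGroup H] [InnerProductSpace ℂ H]
  [NormedAddCommGroup R] [InnerProductSpace ℂ R] {D : Submodule ℂ H}

/-- `T : H ⊇ D → R` is bijective with a bounded inverse `R → H`. -/
def HasBoundedInverse (T : D →ₗ[ℂ] R) : Prop :=
  Function.Bijective T ∧ ∃ c : ℝ, 0 < c ∧ ∀ u : D, ‖(u : H)‖ ≤ c * ‖T u‖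

/-- The range of `T` is closed in `R`. -/
def HasClosedRange (T : D →ₗ[ℂ] R) : Prop :=
  IsClosed (LinearMap.range T : Set R)

/-- The kernel of `T` is finite-dimensional. -/
def HasFiniteKernel (T : D →ₗ[ℂ] R) : Prop :=
  FiniteDimensional ℂ (LinearMap.ker T)

/-- The cokernel `R / Ran T` is finite-dimensional. -/
def HasFiniteCokernel (T : D →ₗ[ℂ] R) : Prop :=
  FiniteDimensional ℂ (R ⧸ LinearMap.range T)

/-- Closed range, and the kernel or the cokernel is finite-dimensional. -/
def IsSemiFredholm (T : D →ₗ[ℂ] R) : Prop :=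
  HasClosedRange T ∧ (HasFiniteKernel T ∨ HasFiniteCokernel T)

/-- Closed range, finite-dimensional kernel and cokernel. -/
def IsFredholm (T : D →ₗ[ℂ] R) : Prop :=
  HasClosedRange T ∧ HasFiniteKernel T ∧ HasFiniteCokernel T

/-- Fredholm with `dim ker T = dim coker T`. -/
def IsFredholmIndexZero (T : D →ₗ[ℂ] R) : Prop :=
  IsFredholm T ∧
    Module.finrank ℂ (LinearMap.ker T) = Module.finrank ℂ (R ⧸ LinearMap.range T)

end Operators

namespace OperatorPencil

variable {Ω H R : Type*} [NormedAddCommGroup H] [InnerProductSpace ℂ H]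
  [NormedAddCommGroup R] [InnerProductSpace ℂ R]

/-- `P(ω; lam) = A(ω) - lam * B(ω)`. -/
def op (P : OperatorPencil Ω H R) (ω : Ω) (lam : ℂ) : P.dom ω →ₗ[ℂ] R :=
  P.A ω - lam • P.B ω

/-- The resolvent set `ρ(P)`. -/
def resolventSet (P : OperatorPencil Ω H R) : Set Ω :=
  {ω | HasBoundedInverse (P.op ω 1)}

/-- The spectrum `σ(P) = Ω \ ρ(P)`. -/
def spectrum (P : OperatorPencil Ω H R) : Set Ω :=
  (P.resolventSet)ᶜ

/-- The point spectrum (set of eigenvalues). -/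
def pointSpectrum (P : OperatorPencil Ω H R) : Set Ω :=
  {ω | ∃ u : P.dom ω, u ≠ 0 ∧ P.op ω 1 u = 0}

/-- The algebraic multiplicity of `lam` as an eigenvalue of `P(ω; ·)` is infinite: the eigenspace
is infinite-dimensional, or there is an infinite linearly independent Jordan chain. -/
def InfiniteAlgMult (P : OperatorPencil Ω H R) (ω : Ω) (lam : ℂ) : Prop :=
  ¬ FiniteDimensional ℂ (LinearMap.ker (P.op ω lam)) ∨
  ∃ u : ℕ → P.dom ω, LinearIndependent ℂ u ∧
    u 0 ≠ 0 ∧ P.op ω lam (u 0) = 0 ∧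
    ∀ k, P.op ω lam (u (k + 1)) = P.B ω (u k)

/-- Eigenvalues of finite algebraic multiplicity. -/
def finitePointSpectrum (P : OperatorPencil Ω H R) : Set Ω :=
  {ω | ω ∈ P.pointSpectrum ∧ ¬ P.InfiniteAlgMult ω 1}

/-- Eigenvalues of infinite algebraic multiplicity. -/
def infinitePointSpectrum (P : OperatorPencil Ω H R) : Set Ω :=
  {ω | ω ∈ P.pointSpectrum ∧ P.InfiniteAlgMult ω 1}

/-- Weyl sequence at `ω`: normalized in `H`, weakly null in `H`, and `P(ω; 1) u n → 0` in `R`. -/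
def IsWeylSequence (P : OperatorPencil Ω H R) (ω : Ω) (u : ℕ → P.dom ω) : Prop :=
  (∀ n, ‖(u n : H)‖ = 1) ∧
  (∀ v : H, Tendsto (fun n => inner ℂ v (u n : H)) atTop (𝓝 0)) ∧
  Tendsto (fun n => ‖P.op ω 1 (u n)‖) atTop (𝓝 0)

/-- The Weyl spectrum. -/
def weylSpectrum (P : OperatorPencil Ω H R) : Set Ω :=
  {ω | ∃ u : ℕ → P.dom ω, P.IsWeylSequence ω u}

/-- The essential spectrum `σ_{e,1}`. -/
def essSpectrum1 (P : OperatorPencil Ω H R) : Set Ω :=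
  {ω | ¬ IsSemiFredholm (P.op ω 1)}

/-- The essential spectrum `σ_{e,2}`. -/
def essSpectrum2 (P : OperatorPencil Ω H R) : Set Ω :=
  {ω | ¬ (IsSemiFredholm (P.op ω 1) ∧ HasFiniteKernel (P.op ω 1))}

/-- The essential spectrum `σ_{e,3}`. -/
def essSpectrum3 (P : OperatorPencil Ω H R) : Set Ω :=
  {ω | ¬ IsFredholm (P.op ω 1)}

/-- The essential spectrum `σ_{e,4}`. -/
def essSpectrum4 (P : OperatorPencil Ω H R) : Set Ω :=
  {ω | ¬ IsFredholmIndexZero (P.op ω 1)}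

/-- `{lam : P(ω; lam) is semi-Fredholm}`. -/
def semiFredholmSet (P : OperatorPencil Ω H R) (ω : Ω) : Set ℂ :=
  {lam | IsSemiFredholm (P.op ω lam)}

/-- The resolvent set of `P(ω; ·)` in the `lam`-plane. -/
def lamResolventSet (P : OperatorPencil Ω H R) (ω : Ω) : Set ℂ :=
  {lam | HasBoundedInverse (P.op ω lam)}

/-- `Δ(P(ω; ·))`: the union of the connected components of the semi-Fredholm set that contain a
point of the resolvent set of `P(ω; ·)`. -/
def Delta (P : OperatorPencil Ω H R) (ω : Ω) : Set ℂ :=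
  {lam | ∃ μ ∈ connectedComponentIn (P.semiFredholmSet ω) lam, μ ∈ P.lamResolventSet ω}

/-- The essential spectrum `σ_{e,5}`. -/
def essSpectrum5 (P : OperatorPencil Ω H R) : Set Ω :=
  {ω | (1 : ℂ) ∉ P.Delta ω}

end OperatorPencil

/-! ### Weak vector calculus on the plane

Coordinates `x₁, x₂` have indices `0, 1 : Fin 2`; the components `E₁, E₂, E₃` of a field have
indices `0, 1, 2 : Fin 3`; the gradient is `∇ = (∂₁, ∂₂, 0)`. -/

namespace Maxwell2D

/-- `ℝ²`. -/
abbrev Plane : Type := EuclideanSpace ℝ (Fin 2)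

/-- `L²(ℝ², ℂ³)`. -/
abbrev L2 : Type := Lp (EuclideanSpace ℂ (Fin 3)) 2 (volume : Measure Plane)

/-- Scalar test functions, `C_c^∞(ℝ², ℂ)`. -/
def IsTest (φ : Plane → ℂ) : Prop :=
  ContDiff ℝ (⊤ : ℕ∞) φ ∧ HasCompactSupport φ

/-- The partial derivative of `φ` with respect to the `i`-th coordinate. -/
def pd (i : Fin 2) (φ : Plane → ℂ) (x : Plane) : ℂ :=
  fderiv ℝ φ x (EuclideanSpace.single i 1)

/-- `∫ uⱼ φ dx`. -/
def pairing (u : L2) (j : Fin 3) (φ : Plane → ℂ) : ℂ :=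
  ∫ x, u x j * φ x

/-- `G = ∇ × E = (∂₂E₃, -∂₁E₃, ∂₁E₂ - ∂₂E₁)` in the sense of distributions. -/
def HasWeakCurl (E G : L2) : Prop :=
  ∀ φ : Plane → ℂ, IsTest φ →
    pairing G 0 φ = -pairing E 2 (pd 1 φ) ∧
    pairing G 1 φ = pairing E 2 (pd 0 φ) ∧
    pairing G 2 φ = -pairing E 1 (pd 0 φ) + pairing E 0 (pd 1 φ)

/-- `∇ · u = ∂₁u₁ + ∂₂u₂ = 0` in the sense of distributions. -/
def IsDivFree (u : L2) : Prop :=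
  ∀ φ : Plane → ℂ, IsTest φ → pairing u 0 (pd 0 φ) + pairing u 1 (pd 1 φ) = 0

theorem IsTest.pd {φ : Plane → ℂ} (h : IsTest φ) (i : Fin 2) : IsTest (pd i φ) := by
  refine ⟨?_, ?_⟩
  · exact (h.1.fderiv_right (m := (⊤ : ℕ∞)) (by simp)).clm_apply contDiff_const
  · exact (h.2.fderiv (𝕜 := ℝ)).comp_left (g := fun L => L (EuclideanSpace.single i 1)) (by simp)

theorem pd_comm {φ : Plane → ℂ} (h : IsTest φ) : pd 0 (pd 1 φ) = pd 1 (pd 0 φ) := by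
  funext x
  have hd : DifferentiableAt ℝ (fderiv ℝ φ) x :=
    ((h.1.fderiv_right (m := (⊤ : ℕ∞)) (by simp)).differentiable (by simp)) x
  have hs : IsSymmSndFDerivAt ℝ φ x := h.1.contDiffAt.isSymmSndFDerivAt (by simpa using WithTop.coe_le_coe.2 (le_top : (2 : ℕ∞) ≤ ⊤))
  have key : ∀ i j : Fin 2, pd i (pd j φ) x =
      fderiv ℝ (fderiv ℝ φ) x (EuclideanSpace.single i 1) (EuclideanSpace.single j 1) := by
    intro i j
    change fderiv ℝ (fun y => fderiv ℝ φ y (EuclideanSpace.single j 1)) x _ = _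
    rw [fderiv_clm_apply hd (differentiableAt_const _)]
    simp
  rw [key, key, hs]

theorem memLp_comp (u : L2) (j : Fin 3) : MemLp (fun x => u x j) 2 (volume : Measure Plane) :=
  (EuclideanSpace.proj j : EuclideanSpace ℂ (Fin 3) →L[ℂ] ℂ).comp_memLp' (Lp.memLp u)

theorem IsTest.memLp {φ : Plane → ℂ} (h : IsTest φ) : MemLp φ 2 (volume : Measure Plane) :=
  h.1.continuous.memLp_of_hasCompactSupport h.2

theorem integrable_pairing (u : L2) (j : Fin 3) {φ : Plane → ℂ} (h : IsTest φ) :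
    Integrable (fun x => u x j * φ x) (volume : Measure Plane) :=
  (memLp_comp u j).integrable_mul h.memLp

theorem pairing_add (u v : L2) (j : Fin 3) {φ : Plane → ℂ} (h : IsTest φ) :
    pairing (u + v) j φ = pairing u j φ + pairing v j φ := by
  unfold pairing
  rw [← integral_add (integrable_pairing u j h) (integrable_pairing v j h)]
  refine integral_congr_ae ?_
  filter_upwards [Lp.coeFn_add u v] with x hx
  rw [hx]
  simp [add_mul]

theorem pairing_smul (c : ℂ) (u : L2) (j : Fin 3) (φ : Plane → ℂ) :
    pairing (c • u) j φ = c * pairing u j φ := by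
  unfold pairing
  rw [← integral_const_mul]
  refine integral_congr_ae ?_
  filter_upwards [Lp.coeFn_smul c u] with x hx
  rw [hx]
  simp [mul_assoc]

theorem pairing_zero (j : Fin 3) (φ : Plane → ℂ) : pairing 0 j φ = 0 := by
  simpa using pairing_smul 0 0 j φ

theorem eq_zero_of_pairing {u : L2} (h : ∀ j φ, IsTest φ → pairing u j φ = 0) : u = 0 := by
  have hj : ∀ j : Fin 3, ∀ᵐ x ∂(volume : Measure Plane), u x j = 0 := by
    intro j
    refine ae_eq_zero_of_integral_contDiff_smul_eq_zero
      ((memLp_comp u j).locallyIntegrable (by norm_num)) ?_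
    intro g hg hc
    have := h j (fun x => (g x : ℂ)) ⟨Complex.ofRealCLM.contDiff.comp hg,
      hc.comp_left (g := fun r : ℝ => (r : ℂ)) (by simp)⟩
    rw [← this]
    unfold pairing
    refine integral_congr_ae (Eventually.of_forall fun x => ?_)
    simp [mul_comm]
  refine (Lp.eq_zero_iff_ae_eq_zero).2 ?_
  filter_upwards [ae_all_iff.2 hj] with x hx
  ext j
  simpa using hx j

theorem HasWeakCurl.add {E G E' G' : L2} (h : HasWeakCurl E G) (h' : HasWeakCurl E' G') :
    HasWeakCurl (E + E') (G + G') := by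
  intro φ hφ
  obtain ⟨h0, h1, h2⟩ := h φ hφ
  obtain ⟨h0', h1', h2'⟩ := h' φ hφ
  have d0 := hφ.pd 0
  have d1 := hφ.pd 1
  refine ⟨?_, ?_, ?_⟩
  · rw [pairing_add _ _ _ hφ, pairing_add _ _ _ d1, h0, h0']; ring
  · rw [pairing_add _ _ _ hφ, pairing_add _ _ _ d0, h1, h1']
  · rw [pairing_add _ _ _ hφ, pairing_add _ _ _ d0, pairing_add _ _ _ d1, h2, h2']; ring

theorem HasWeakCurl.smul {E G : L2} (c : ℂ) (h : HasWeakCurl E G) :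
    HasWeakCurl (c • E) (c • G) := by
  intro φ hφ
  obtain ⟨h0, h1, h2⟩ := h φ hφ
  refine ⟨?_, ?_, ?_⟩
  · rw [pairing_smul, pairing_smul, h0]; ring
  · rw [pairing_smul, pairing_smul, h1]
  · rw [pairing_smul, pairing_smul, pairing_smul, h2]; ring

theorem HasWeakCurl.zero : HasWeakCurl 0 0 := by
  intro φ _
  simp [pairing_zero]

theorem HasWeakCurl.unique {E G G' : L2} (h : HasWeakCurl E G) (h' : HasWeakCurl E G') :
    G = G' := by
  have hs : HasWeakCurl 0 (G + (-1 : ℂ) • G') := by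
    have := h.add (h'.smul (-1))
    simpa using this
  have h0 : G + (-1 : ℂ) • G' = 0 := by
    refine eq_zero_of_pairing fun j φ hφ => ?_
    obtain ⟨h0, h1, h2⟩ := hs φ hφ
    simp only [pairing_zero, neg_zero, add_zero] at h0 h1 h2
    fin_cases j
    · exact h0
    · exact h1
    · exact h2
  have : G - G' = 0 := by simpa [sub_eq_add_neg] using h0
  exact sub_eq_zero.1 this

theorem HasWeakCurl.isDivFree {E G : L2} (h : HasWeakCurl E G) : IsDivFree G := by
  intro φ hφ
  rw [(h _ (hφ.pd 0)).1, (h _ (hφ.pd 1)).2.1, pd_comm hφ]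
  ring

/-- The space of divergence-free fields, with the `L²` inner product. -/
def rangeSpace : Submodule ℂ L2 where
  carrier := {r | IsDivFree r}
  zero_mem' := by
    intro φ _
    simp [pairing_zero]
  add_mem' := by
    intro a b ha hb φ hφ
    rw [pairing_add _ _ _ (hφ.pd 0), pairing_add _ _ _ (hφ.pd 1)]
    linear_combination ha φ hφ + hb φ hφ
  smul_mem' := by
    intro c a ha φ hφ
    rw [pairing_smul, pairing_smul]
    linear_combination c * ha φ hφ

/-- The coefficient equal to `a` on `{x₁ > 0}` and to `b` on `{x₁ < 0}` (the value on the null set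
`{x₁ = 0}` is irrelevant). -/
def step (a b : ℂ) (x : Plane) : ℂ := if 0 < x 0 then a else b

theorem memLp_step_smul (a b : ℂ) (u : L2) :
    MemLp (fun x => step a b x • u x) 2 (volume : Measure Plane) := by
  have hm : Measurable (step a b) := by
    unfold step
    refine Measurable.ite (measurableSet_lt measurable_const ?_) measurable_const measurable_const
    fun_prop
  refine MemLp.of_le_mul (c := ‖a‖ + ‖b‖) (Lp.memLp u)
    (hm.aestronglyMeasurable.smul (Lp.memLp u).1) (Eventually.of_forall fun x => ?_)
  rw [norm_smul]
  refine mul_le_mul_of_nonneg_right ?_ (norm_nonneg _)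
  unfold step
  split_ifs
  · linarith [norm_nonneg b]
  · linarith [norm_nonneg a]

/-- Multiplication by the piecewise constant coefficient `step a b` on `L²(ℝ², ℂ³)`. -/
def mulStep (a b : ℂ) : L2 →ₗ[ℂ] L2 where
  toFun u := (memLp_step_smul a b u).toLp _
  map_add' := by
    intro u v
    rw [← MemLp.toLp_add]
    refine MemLp.toLp_congr _ _ ?_
    filter_upwards [Lp.coeFn_add u v] with x hx
    rw [hx]
    simp
  map_smul' := by
    intro c u
    rw [RingHom.id_apply, ← MemLp.toLp_const_smul]
    refine MemLp.toLp_congr _ _ ?_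
    filter_upwards [Lp.coeFn_smul c u] with x hx
    rw [hx]
    simp [smul_comm c]

theorem mulStep_mul (c a b : ℂ) (u : L2) : mulStep (c * a) (c * b) u = c • mulStep a b u := by
  change (memLp_step_smul (c * a) (c * b) u).toLp _ = c • (memLp_step_smul a b u).toLp _
  rw [← MemLp.toLp_const_smul]
  refine MemLp.toLp_congr _ _ (Eventually.of_forall fun x => ?_)
  simp only [Pi.smul_apply, step]
  split_ifs <;> simp [mul_smul]

/-! ### The Maxwell pencil

`S` is the set of singularities, and `Wp, Wm` are the two values of the coefficient, on
`{x₁ > 0}` and on `{x₁ < 0}`, as functions of the frequency `ω ∈ ℂ \ S`. -/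

/-- The domain `{E ∈ L² : ∇ × E ∈ L², ∇ × ∇ × E ∈ L², ∇ · (w E) = 0}`, where `w = wp` on
`{x₁ > 0}` and `w = wm` on `{x₁ < 0}`. -/
def domain (wp wm : ℂ) : Submodule ℂ L2 where
  carrier := {E | (∃ G F : L2, HasWeakCurl E G ∧ HasWeakCurl G F) ∧
    IsDivFree (mulStep wp wm E)}
  zero_mem' := ⟨⟨0, 0, HasWeakCurl.zero, HasWeakCurl.zero⟩, by
    rw [map_zero]; exact rangeSpace.zero_mem⟩
  add_mem' := by
    rintro E E' ⟨⟨G, F, h1, h2⟩, h3⟩ ⟨⟨G', F', h1', h2'⟩, h3'⟩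
    refine ⟨⟨G + G', F + F', h1.add h1', h2.add h2'⟩, ?_⟩
    rw [map_add]
    exact rangeSpace.add_mem h3 h3'
  smul_mem' := by
    rintro c E ⟨⟨G, F, h1, h2⟩, h3⟩
    refine ⟨⟨c • G, c • F, h1.smul c, h2.smul c⟩, ?_⟩
    rw [map_smul]
    exact rangeSpace.smul_mem c h3

theorem exists_curlCurl {wp wm : ℂ} (E : domain wp wm) :
    ∃ F : L2, ∃ G : L2, HasWeakCurl E G ∧ HasWeakCurl G F := by
  obtain ⟨⟨G, F, h⟩, _⟩ := E.2
  exact ⟨F, G, h⟩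

/-- `∇ × ∇ × E` for `E` in the domain. -/
def curlCurlFun {wp wm : ℂ} (E : domain wp wm) : L2 := (exists_curlCurl E).choose

theorem curlCurlFun_eq {wp wm : ℂ} (E : domain wp wm) {G F : L2}
    (h1 : HasWeakCurl E G) (h2 : HasWeakCurl G F) : curlCurlFun E = F := by
  obtain ⟨G', h1', h2'⟩ := (exists_curlCurl E).choose_spec
  obtain rfl := h1.unique h1'
  exact h2'.unique h2

/-- The operator `E ↦ ∇ × ∇ × E` from the domain to the divergence-free fields. -/
def curlCurl (wp wm : ℂ) : domain wp wm →ₗ[ℂ] rangeSpace where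
  toFun E := ⟨curlCurlFun E, by
    obtain ⟨G, _, h⟩ := (exists_curlCurl E).choose_spec
    exact h.isDivFree⟩
  map_add' := by
    intro E E'
    obtain ⟨G, h1, h2⟩ := (exists_curlCurl E).choose_spec
    obtain ⟨G', h1', h2'⟩ := (exists_curlCurl E').choose_spec
    exact Subtype.ext (curlCurlFun_eq (E + E') (h1.add h1') (h2.add h2'))
  map_smul' := by
    intro c E
    obtain ⟨G, h1, h2⟩ := (exists_curlCurl E).choose_spec
    exact Subtype.ext (curlCurlFun_eq (c • E) (h1.smul c) (h2.smul c))

/-- The operator `E ↦ c w E` from the domain to the divergence-free fields, where `w = wp` on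
`{x₁ > 0}` and `w = wm` on `{x₁ < 0}`. -/
def mulCoeff (c wp wm : ℂ) : domain wp wm →ₗ[ℂ] rangeSpace :=
  ((mulStep (c * wp) (c * wm)).comp (domain wp wm).subtype).codRestrict rangeSpace (by
    intro E
    change mulStep (c * wp) (c * wm) (E : L2) ∈ rangeSpace
    rw [mulStep_mul]
    exact rangeSpace.smul_mem c E.2.2)

/-- The two-dimensional Maxwell pencil `L(ω; lam) E = ∇ × ∇ × E - lam W(x₁, ω) E`, with
`W = ω² W̃` and `W̃ = Wp` on `{x₁ > 0}`, `W̃ = Wm` on `{x₁ < 0}`. -/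
def pencil (S : Set ℂ) (Wp Wm : (Sᶜ : Set ℂ) → ℂ) :
    OperatorPencil (Sᶜ : Set ℂ) L2 rangeSpace where
  dom ω := domain (Wp ω) (Wm ω)
  A ω := curlCurl (Wp ω) (Wm ω)
  B ω := mulCoeff ((ω : ℂ) ^ 2) (Wp ω) (Wm ω)

/-- The exceptional set `Ω₀`: the frequencies where `ω² W̃₊(ω) = 0` or `ω² W̃₋(ω) = 0`. -/
def exceptionalSet (S : Set ℂ) (Wp Wm : (Sᶜ : Set ℂ) → ℂ) : Set (Sᶜ : Set ℂ) :=
  {ω | (ω : ℂ) ^ 2 * Wp ω = 0 ∨ (ω : ℂ) ^ 2 * Wm ω = 0}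

end Maxwell2D

end

/-! On the exceptional set the coefficient `W` vanishes on at least one of the two half-planes. A
field `(0, 0, φ)` with `φ` supported there satisfies the divergence constraint trivially, and the
operator maps it to `(0, 0, -Δφ)`. The dilations `t φ(t x)` keep the `L²` norm while the norm of the
Laplacian scales like `t²`. Taking `t = 4⁻ⁿ` makes the supports disjoint, so one gets an orthonormal
sequence `e` with `T e → 0` (`exists_test_sequence`, `exists_singular_sequence`). It is a Weyl
sequence.

The operator is not semi-Fredholm because it acts symmetrically on this sequence: `⟨f, T u⟩ = ⟨T e,
u⟩` for every `u`, where `f` is `e` seen in the range space. With closed range, vectors of the range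
have approximate preimages of controlled norm, so no bounded vectors `r n` of the range can satisfy
`⟨f n, r n⟩ → 1` (`not_hasClosedRange_of_tendsto`). If one of the values of `W̃` vanishes, the
kernel is infinite-dimensional, since it contains the gradients of test functions supported where
`W̃ = 0`. The cokernel would then have to be finite-dimensional, which puts `f n` in the range up to
a null sequence. If neither value vanishes, then `ω = 0`. A vector orthogonal to the range has a
harmonic third component, which is zero by Liouville, so closed range would put `f n` itself in the
range. All five essential spectra and the spectrum follow from this failure.

For the eigenvalues it remains to treat `ω = 0` with both values nonzero. By Liouville, a kernel
element is curl-free. It is also divergence-free with weight `W̃`. Combining it with its reflection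
across the interface gives pairs that are divergence- and curl-free on the whole plane, hence zero,
and comparing weighted and unweighted pairs gives `(W̃₊ + W̃₋) E = 0` for the first two components
(`eq_zero_of_curlFree_of_weighted_divFree`). If the sum vanishes, holomorphic functions on a
half-plane, extended by reflection, form an infinite-dimensional kernel (`surfaceField`). Thus on
the exceptional set the kernel is either trivial or infinite-dimensional. -/

noncomputable section

namespace Maxwell2D

open scoped ComplexConjugate

/-! ### Calculus of test functions -/

namespace IsTest

variable {φ ψ : Plane → ℂ}

theorem continuous (h : IsTest φ) : Continuous φ := h.1.continuous

theorem differentiable (h : IsTest φ) : Differentiable ℝ φ := h.1.differentiable (by simp)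

theorem integrable (h : IsTest φ) : Integrable φ (volume : Measure Plane) :=
  h.continuous.integrable_of_hasCompactSupport h.2

theorem add (h : IsTest φ) (h' : IsTest ψ) : IsTest (fun x => φ x + ψ x) :=
  ⟨h.1.add h'.1, h.2.add h'.2⟩

theorem mul_left {f : Plane → ℂ} (hf : ContDiff ℝ (⊤ : ℕ∞) f) (h : IsTest φ) :
    IsTest (fun x => f x * φ x) :=
  ⟨hf.mul h.1, h.2.mul_left⟩

theorem mul (h : IsTest φ) (h' : IsTest ψ) : IsTest (fun x => φ x * ψ x) :=
  mul_left h.1 h'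

theorem const_mul (h : IsTest φ) (c : ℂ) : IsTest (fun x => c * φ x) :=
  mul_left contDiff_const h

theorem neg (h : IsTest φ) : IsTest (fun x => -φ x) := by
  simpa using h.const_mul (-1)

theorem sub (h : IsTest φ) (h' : IsTest ψ) : IsTest (fun x => φ x - ψ x) := by
  simpa [sub_eq_add_neg] using h.add h'.neg

theorem conjugate (h : IsTest φ) : IsTest (fun x => conj (φ x)) :=
  ⟨(Complex.conjCLE : ℂ →L[ℝ] ℂ).contDiff.comp h.1,
    h.2.comp_left (g := fun z : ℂ => conj z) (by simp)⟩

theorem translate (h : IsTest φ) (a : Plane) : IsTest (fun x => φ (x + a)) :=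
  ⟨h.1.comp (contDiff_id.add contDiff_const), h.2.comp_homeomorph (Homeomorph.addRight a)⟩

theorem comp_equiv (h : IsTest φ) (T : Plane ≃L[ℝ] Plane) : IsTest (fun x => φ (T x)) :=
  ⟨h.1.comp T.contDiff, h.2.comp_homeomorph T.toHomeomorph⟩

theorem dilate (h : IsTest φ) {t : ℝ} (ht : t ≠ 0) : IsTest (fun x => φ (t • x)) :=
  h.comp_equiv (ContinuousLinearEquiv.smulLeft (Units.mk0 t ht))

end IsTest

section pd

variable {φ ψ : Plane → ℂ} (i : Fin 2)

theorem pd_add (h : IsTest φ) (h' : IsTest ψ) :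
    pd i (fun x => φ x + ψ x) = fun x => pd i φ x + pd i ψ x := by
  funext x
  simp only [pd]
  rw [fderiv_fun_add (h.differentiable x) (h'.differentiable x)]
  rfl

theorem pd_mul {f : Plane → ℂ} (hf : Differentiable ℝ f) (h : IsTest φ) :
    pd i (fun x => f x * φ x) = fun x => f x * pd i φ x + pd i f x * φ x := by
  funext x
  simp only [pd]
  rw [fderiv_fun_mul (hf x) (h.differentiable x)]
  simp [mul_comm]

theorem pd_const_mul (h : IsTest φ) (c : ℂ) :
    pd i (fun x => c * φ x) = fun x => c * pd i φ x := by
  rw [pd_mul i (differentiable_const c) h]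
  funext x
  simp [pd]

theorem pd_sub (h : IsTest φ) (h' : IsTest ψ) :
    pd i (fun x => φ x - ψ x) = fun x => pd i φ x - pd i ψ x := by
  funext x
  simp only [pd]
  rw [fderiv_fun_sub (h.differentiable x) (h'.differentiable x)]
  rfl

theorem pd_conj (h : IsTest φ) : pd i (fun x => conj (φ x)) = fun x => conj (pd i φ x) := by
  funext x
  simp only [pd]
  have := ((Complex.conjCLE : ℂ →L[ℝ] ℂ).hasFDerivAt.comp x (h.differentiable x).hasFDerivAt).fderiv
  have h2 : fderiv ℝ (fun x => conj (φ x)) x =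
    (Complex.conjCLE : ℂ →L[ℝ] ℂ).comp (fderiv ℝ φ x) := this
  rw [h2]
  simp

theorem pd_translate (a : Plane) : pd i (fun x => φ (x + a)) = fun x => pd i φ (x + a) := by
  funext x
  simp only [pd]
  rw [fderiv_comp_add_right]

theorem pd_comp_equiv (h : IsTest φ) (T : Plane ≃L[ℝ] Plane) (x : Plane) :
    pd i (fun x => φ (T x)) x = fderiv ℝ φ (T x) (T (EuclideanSpace.single i 1)) := by
  simp only [pd]
  have h2 : fderiv ℝ (fun x => φ (T x)) x =
    (fderiv ℝ φ (T x)).comp (T : Plane →L[ℝ] Plane) :=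
    ((h.differentiable (T x)).hasFDerivAt.comp x T.hasFDerivAt).fderiv
  rw [h2]
  rfl

theorem pd_dilate (h : IsTest φ) {t : ℝ} (ht : t ≠ 0) :
    pd i (fun x => φ (t • x)) = fun x => (t : ℂ) * pd i φ (t • x) := by
  funext x
  refine (pd_comp_equiv i h (ContinuousLinearEquiv.smulLeft (Units.mk0 t ht)) x).trans ?_
  change fderiv ℝ φ (t • x) (t • EuclideanSpace.single i 1) = _
  rw [map_smul]
  simp [pd]

theorem pd_congr_of_eventuallyEq {x : Plane} (h : φ =ᶠ[𝓝 x] ψ) : pd i φ x = pd i ψ x := by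
  simp only [pd, h.fderiv_eq]

theorem pd_eq_zero_of_notMem_tsupport {x : Plane} (h : x ∉ tsupport φ) : pd i φ x = 0 := by
  simp only [pd, fderiv_of_notMem_tsupport ℝ h]
  rfl

theorem integral_pd_mul (h : IsTest φ) (h' : IsTest ψ) :
    ∫ x, pd i φ x * ψ x = -∫ x, φ x * pd i ψ x := by
  have := integral_mul_fderiv_eq_neg_fderiv_mul_of_integrable (μ := (volume : Measure Plane))
    (v := EuclideanSpace.single i (1 : ℝ)) (f := φ) (g := ψ)
    ((h.pd i).mul h').integrable (h.mul (h'.pd i)).integrable (h.mul h').integrable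
    (fun x _ => h.differentiable x) (fun x _ => h'.differentiable x)
  change ∫ x, φ x * pd i ψ x = -∫ x, pd i φ x * ψ x at this
  rw [this, neg_neg]

end pd

/-- The Laplacian of a test function. -/
def lap (φ : Plane → ℂ) (x : Plane) : ℂ := pd 0 (pd 0 φ) x + pd 1 (pd 1 φ) x

theorem IsTest.lap {φ : Plane → ℂ} (h : IsTest φ) : IsTest (lap φ) :=
  ((h.pd 0).pd 0).add ((h.pd 1).pd 1)

theorem lap_conj {φ : Plane → ℂ} (h : IsTest φ) :
    lap (fun x => conj (φ x)) = fun x => conj (lap φ x) := by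
  funext x
  simp only [lap, pd_conj _ h, pd_conj _ (h.pd _), map_add]

theorem lap_dilate {φ : Plane → ℂ} (h : IsTest φ) {t : ℝ} (ht : t ≠ 0) :
    lap (fun x => φ (t • x)) = fun x => (t : ℂ) ^ 2 * lap φ (t • x) := by
  funext x
  simp only [lap, pd_dilate _ h ht, pd_const_mul _ ((h.pd _).dilate ht), pd_dilate _ (h.pd _) ht]
  ring

theorem lap_const_mul {φ : Plane → ℂ} (h : IsTest φ) (c : ℂ) :
    lap (fun x => c * φ x) = fun x => c * lap φ x := by
  funext x
  simp only [lap, pd_const_mul _ h, pd_const_mul _ (h.pd _)]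
  ring

/-! ### Linearity of the pairing in the test function -/

section pairing

variable {φ ψ : Plane → ℂ} (u : L2) (j : Fin 3)

theorem pairing_fun_add (h : IsTest φ) (h' : IsTest ψ) :
    pairing u j (fun x => φ x + ψ x) = pairing u j φ + pairing u j ψ := by
  unfold pairing
  rw [← integral_add (integrable_pairing u j h) (integrable_pairing u j h')]
  simp [mul_add]

theorem pairing_fun_sub (h : IsTest φ) (h' : IsTest ψ) :
    pairing u j (fun x => φ x - ψ x) = pairing u j φ - pairing u j ψ := by
  unfold pairing
  rw [← integral_sub (integrable_pairing u j h) (integrable_pairing u j h')]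
  simp [mul_sub]

theorem pairing_const_mul (c : ℂ) :
    pairing u j (fun x => c * φ x) = c * pairing u j φ := by
  unfold pairing
  rw [← integral_const_mul]
  congr 1
  funext x
  ring

theorem pairing_fun_neg : pairing u j (fun x => -φ x) = -pairing u j φ := by
  simpa using pairing_const_mul (φ := φ) u j (-1)

theorem pairing_sub (v : L2) (h : IsTest φ) :
    pairing (u - v) j φ = pairing u j φ - pairing v j φ := by
  have := pairing_add u ((-1 : ℂ) • v) j h
  rw [pairing_smul] at this
  simpa [sub_eq_add_neg] using this

end pairing

/-! ### Test fields -/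

theorem memLp_single (j : Fin 3) {φ : Plane → ℂ} (h : IsTest φ) :
    MemLp (fun x => EuclideanSpace.single j (φ x)) 2 (volume : Measure Plane) := by
  refine h.memLp.of_le (Continuous.aestronglyMeasurable ?_) (Eventually.of_forall fun x => by simp)
  refine (PiLp.continuous_toLp 2 _).comp (continuous_pi fun k => ?_)
  by_cases hk : k = j
  · subst hk
    simpa using h.continuous
  · simpa [hk] using continuous_const

/-- The field whose `j`-th component is the test function `φ`, the other components being `0`. -/
def testField (j : Fin 3) (φ : Plane → ℂ) (h : IsTest φ) : L2 := (memLp_single j h).toLp _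

section testField

variable {φ ψ : Plane → ℂ} (j k : Fin 3)

theorem coeFn_testField (h : IsTest φ) :
    testField j φ h =ᵐ[volume] fun x => EuclideanSpace.single j (φ x) :=
  MemLp.coeFn_toLp _

theorem pairing_testField_same (h : IsTest φ) : pairing (testField j φ h) j ψ = ∫ x, φ x * ψ x := by
  unfold pairing
  refine integral_congr_ae ?_
  filter_upwards [coeFn_testField j h] with x hx
  simp [hx]

theorem pairing_testField_of_ne (h : IsTest φ) (hjk : k ≠ j) :
    pairing (testField j φ h) k ψ = 0 := by
  unfold pairing
  rw [← integral_zero Plane ℂ]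
  refine integral_congr_ae ?_
  filter_upwards [coeFn_testField j h] with x hx
  simp [hx, hjk]

theorem inner_testField (h : IsTest φ) (u : L2) :
    inner ℂ (testField j φ h) u = pairing u j (fun x => conj (φ x)) := by
  rw [L2.inner_def]
  unfold pairing
  refine integral_congr_ae ?_
  filter_upwards [coeFn_testField j h] with x hx
  rw [hx, EuclideanSpace.inner_single_left, mul_comm]

theorem pairing_eq_inner (h : IsTest φ) (u : L2) :
    pairing u j φ = inner ℂ (testField j (fun x => conj (φ x)) h.conjugate) u := by
  rw [inner_testField]
  simp

theorem norm_sq_testField (h : IsTest φ) :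
    ‖testField j φ h‖ ^ 2 = ∫ x, ‖φ x‖ ^ 2 := by
  rw [@norm_sq_eq_re_inner ℂ, inner_testField, pairing_testField_same]
  have : ∀ x, φ x * conj (φ x) = ((‖φ x‖ ^ 2 : ℝ) : ℂ) := by
    intro x
    rw [Complex.mul_conj, Complex.normSq_eq_norm_sq]
  simp_rw [this]
  rw [integral_complex_ofReal]
  exact Complex.ofReal_re _

theorem testField_congr (h : IsTest φ) (h' : IsTest ψ) (e : φ = ψ) :
    testField j φ h = testField j ψ h' := by
  subst e; rfl

theorem testField_const_mul (h : IsTest φ) (c : ℂ) :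
    testField j (fun x => c * φ x) (h.const_mul c) = c • testField j φ h := by
  unfold testField
  rw [← MemLp.toLp_const_smul]
  refine MemLp.toLp_congr _ _ (Eventually.of_forall fun x => ?_)
  ext k
  simp

theorem inner_testField_of_disjoint (h : IsTest φ) (h' : IsTest ψ) (hd : ∀ x, φ x * ψ x = 0) :
    inner ℂ (testField j φ h) (testField k ψ h') = 0 := by
  rw [inner_testField]
  by_cases hjk : j = k
  · subst hjk
    rw [pairing_testField_same]
    rw [← integral_zero Plane ℂ]
    congr 1
    funext x
    rcases mul_eq_zero.1 (hd x) with h0 | h0 <;> simp [h0]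
  · exact pairing_testField_of_ne _ _ _ hjk

theorem eq_zero_of_testField_eq_zero (h : IsTest φ) (h0 : testField j φ h = 0) : φ = 0 := by
  have h1 : φ =ᵐ[volume] 0 := by
    filter_upwards [coeFn_testField j h, (Lp.eq_zero_iff_ae_eq_zero).1 h0] with x hx hx'
    rw [hx'] at hx
    have := congrArg (fun v : EuclideanSpace ℂ (Fin 3) => v j) hx
    simpa using this.symm
  exact (h.continuous.ae_eq_iff_eq volume continuous_zero).1 h1

end testField

/-! ### Curls of test fields -/

theorem hasWeakCurl_testField_two {φ : Plane → ℂ} (h : IsTest φ) :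
    HasWeakCurl (testField 2 φ h)
      (testField 0 (pd 1 φ) (h.pd 1) + testField 1 _ (h.pd 0).neg) := by
  intro ψ hψ
  have d0 := hψ.pd 0
  have d1 := hψ.pd 1
  simp only [pairing_add _ _ _ hψ, pairing_testField_same,
    pairing_testField_of_ne 0 1 _ (by decide), pairing_testField_of_ne 1 0 _ (by decide),
    pairing_testField_of_ne 0 2 _ (by decide), pairing_testField_of_ne 1 2 _ (by decide),
    pairing_testField_of_ne 2 0 _ (by decide), pairing_testField_of_ne 2 1 _ (by decide)]
  refine ⟨?_, ?_, by simp⟩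
  · rw [add_zero, integral_pd_mul 1 h hψ]
  · simp_rw [neg_mul]
    rw [zero_add, integral_neg, integral_pd_mul 0 h hψ, neg_neg]

theorem hasWeakCurl_curl_testField_two {φ : Plane → ℂ} (h : IsTest φ) :
    HasWeakCurl (testField 0 (pd 1 φ) (h.pd 1) + testField 1 _ (h.pd 0).neg)
      (testField 2 _ h.lap.neg) := by
  intro ψ hψ
  have d0 := hψ.pd 0
  have d1 := hψ.pd 1
  simp only [pairing_add _ _ _ d0, pairing_add _ _ _ d1, pairing_testField_same,
    pairing_testField_of_ne 0 1 _ (by decide), pairing_testField_of_ne 1 0 _ (by decide),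
    pairing_testField_of_ne 0 2 _ (by decide), pairing_testField_of_ne 1 2 _ (by decide),
    pairing_testField_of_ne 2 0 _ (by decide), pairing_testField_of_ne 2 1 _ (by decide)]
  refine ⟨by simp, by simp, ?_⟩
  simp_rw [neg_mul]
  rw [integral_neg, integral_neg]
  have e0 := integral_pd_mul 0 (h.pd 0) hψ
  have e1 := integral_pd_mul 1 (h.pd 1) hψ
  have : ∫ x, lap φ x * ψ x = (∫ x, pd 0 (pd 0 φ) x * ψ x) + ∫ x, pd 1 (pd 1 φ) x * ψ x := by
    rw [← integral_add (((h.pd 0).pd 0).mul hψ).integrable (((h.pd 1).pd 1).mul hψ).integrable]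
    simp [lap, add_mul]
  rw [this, e0, e1]
  ring

theorem hasWeakCurl_gradient {φ : Plane → ℂ} (h : IsTest φ) :
    HasWeakCurl (testField 0 (pd 0 φ) (h.pd 0) + testField 1 (pd 1 φ) (h.pd 1)) 0 := by
  intro ψ hψ
  have d0 := hψ.pd 0
  have d1 := hψ.pd 1
  simp only [pairing_add _ _ _ d0, pairing_add _ _ _ d1, pairing_testField_same, pairing_zero,
    pairing_testField_of_ne 0 1 _ (by decide), pairing_testField_of_ne 1 0 _ (by decide),
    pairing_testField_of_ne 0 2 _ (by decide), pairing_testField_of_ne 1 2 _ (by decide)]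
  refine ⟨by simp, by simp, ?_⟩
  rw [integral_pd_mul 1 h d0, integral_pd_mul 0 h d1, pd_comm hψ]
  ring

/-! ### Completeness of the space of divergence-free fields -/

theorem continuous_pairing (j : Fin 3) {φ : Plane → ℂ} (h : IsTest φ) :
    Continuous fun u : L2 => pairing u j φ := by
  simp_rw [pairing_eq_inner j h]
  fun_prop

theorem isClosed_rangeSpace : IsClosed (rangeSpace : Set L2) := by
  have : (rangeSpace : Set L2) =
      ⋂ (φ : Plane → ℂ) (_ : IsTest φ), {u | pairing u 0 (pd 0 φ) + pairing u 1 (pd 1 φ) = 0} := by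
    ext u
    simp [rangeSpace, IsDivFree]
  rw [this]
  refine isClosed_iInter fun φ => isClosed_iInter fun hφ => ?_
  exact isClosed_eq ((continuous_pairing 0 (hφ.pd 0)).add (continuous_pairing 1 (hφ.pd 1)))
    continuous_const

instance : CompleteSpace rangeSpace := isClosed_rangeSpace.completeSpace_coe

end Maxwell2D

/-! ### Weak convergence, closed ranges and cokernels in Hilbert space. -/

section HilbertSpace

variable {H R : Type*} [NormedAddCommGroup H] [InnerProductSpace ℂ H]
  [NormedAddCommGroup R] [InnerProductSpace ℂ R]

/-- Bessel's inequality makes the squared coefficients summable. -/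
theorem Orthonormal.tendsto_inner_zero {e : ℕ → H} (he : Orthonormal ℂ e) (u : H) :
    Tendsto (fun n => inner ℂ (e n) u) atTop (𝓝 0) := by
  have h := (he.inner_products_summable (x := u)).tendsto_atTop_zero
  refine squeeze_zero_norm (fun n => le_rfl) ?_
  have h2 := h.sqrt
  simpa [Real.sqrt_sq] using h2

theorem tendsto_inner_zero_of_orthogonal {v : ℕ → H} {N : ℝ} (hN : ∀ n, ‖v n‖ = N)
    (hv : ∀ m n, m ≠ n → inner ℂ (v m) (v n) = 0) (u : H) :
    Tendsto (fun n => inner ℂ (v n) u) atTop (𝓝 0) := by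
  by_cases hN0 : N = 0
  · have : ∀ n, v n = 0 := fun n => norm_eq_zero.1 ((hN n).trans hN0)
    simp [this]
  have hN' : ((N : ℂ)) ≠ 0 := by exact_mod_cast hN0
  have he : Orthonormal ℂ fun n => ((N : ℂ)⁻¹) • v n := by
    refine ⟨fun n => ?_, fun m n hmn => ?_⟩
    · have : |N| = N := abs_of_nonneg (hN 0 ▸ norm_nonneg _)
      rw [norm_smul, hN, norm_inv, Complex.norm_real, Real.norm_eq_abs, this, inv_mul_cancel₀ hN0]
    · beta_reduce
      rw [inner_smul_left, inner_smul_right, hv m n hmn, mul_zero, mul_zero]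
  have := (he.tendsto_inner_zero u).const_mul (N : ℂ)
  rw [mul_zero] at this
  refine this.congr fun n => ?_
  rw [inner_smul_left, map_inv₀, Complex.conj_ofReal, mul_inv_cancel_left₀ hN']

/-- A projection of finite rank is compact, so it turns weak convergence into norm convergence. -/
theorem tendsto_norm_starProjection_of_finiteDimensional {e : ℕ → H}
    (he : ∀ v : H, Tendsto (fun n => inner ℂ v (e n)) atTop (𝓝 0))
    (N : Submodule ℂ H) [FiniteDimensional ℂ N] :
    Tendsto (fun n => ‖N.starProjection (e n)‖) atTop (𝓝 0) := by
  let b := stdOrthonormalBasis ℂ N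
  have h : ∀ n, ‖N.starProjection (e n)‖ ≤ ∑ i, ‖inner ℂ (b i : H) (e n)‖ := by
    intro n
    rw [b.starProjection_eq_sum_rankOne]
    simp only [sum_apply, InnerProductSpace.rankOne_apply]
    refine (norm_sum_le _ _).trans (Finset.sum_le_sum fun i _ => ?_)
    rw [norm_smul]
    have : ‖(b i : H)‖ = 1 := b.orthonormal.1 i
    rw [this, mul_one]
  refine squeeze_zero (fun _ => norm_nonneg _) h ?_
  have := tendsto_finsetSum (s := Finset.univ) (x := atTop)
    (f := fun i n => ‖inner ℂ (b i : H) (e n)‖) (a := fun _ => 0)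
    (fun i _ => by simpa using (he (b i)).norm)
  simpa using this

variable {D : Submodule ℂ H}

/-- The approximation step of the open mapping theorem, for a possibly non-closed operator. -/
theorem HasClosedRange.exists_approx_preimage [CompleteSpace R] {T : D →ₗ[ℂ] R}
    (h : HasClosedRange T) :
    ∃ C, 0 ≤ C ∧ ∀ r ∈ LinearMap.range T, ∃ u : D, ‖T u - r‖ ≤ 1 / 2 * ‖r‖ ∧ ‖(u : H)‖ ≤ C * ‖r‖ := by
  let Γ : Submodule ℂ (H × R) := LinearMap.range (D.subtype.prod T)
  have hΓ : ∀ x : Γ, (x : H × R).2 ∈ LinearMap.range T := by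
    rintro ⟨_, u, rfl⟩
    exact ⟨u, rfl⟩
  let f : Γ →L[ℂ] LinearMap.range T :=
    ((ContinuousLinearMap.snd ℂ H R).comp Γ.subtypeL).codRestrict (LinearMap.range T) hΓ
  have hf : Function.Surjective f := by
    rintro ⟨_, u, rfl⟩
    exact ⟨⟨_, u, rfl⟩, rfl⟩
  -- Baire's theorem is applied in the range only; the graph of `T` need not be complete, which is
  -- why the preimages are approximate.
  have : CompleteSpace (LinearMap.range T) := h.completeSpace_coe
  obtain ⟨C, hC, hC'⟩ := f.exists_approx_preimage_norm_le hf
  refine ⟨C, hC, fun r hr => ?_⟩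
  obtain ⟨⟨_, u, rfl⟩, h1, h2⟩ := hC' ⟨r, hr⟩
  refine ⟨u, ?_, ?_⟩
  · rw [dist_eq_norm] at h1
    exact h1
  · exact (le_max_left _ _).trans h2

/-- Here `g n` plays the role of `T* f n`. For an approximate preimage `u` of `r n`, the number `⟨f
n, r n⟩` differs from `⟨g n, u⟩ → 0` by at most `1 / 2`, so it cannot tend to `1` in modulus. -/
theorem not_hasClosedRange_of_tendsto [CompleteSpace R] {T : D →ₗ[ℂ] R} {f r : ℕ → R}
    {g : ℕ → H} (hfg : ∀ n (u : D), inner ℂ (f n) (T u) = inner ℂ (g n) (u : H))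
    (hf : ∀ n, ‖f n‖ ≤ 1) (hg : Tendsto (fun n => ‖g n‖) atTop (𝓝 0))
    (hr : ∀ n, r n ∈ LinearMap.range T) (hr' : ∀ n, ‖r n‖ ≤ 1)
    (hfr : Tendsto (fun n => ‖inner ℂ (f n) (r n)‖) atTop (𝓝 1)) : ¬ HasClosedRange T := by
  intro h
  obtain ⟨C, hC, hT⟩ := h.exists_approx_preimage
  have key : ∀ n, ‖inner ℂ (f n) (r n)‖ ≤ ‖g n‖ * C + 1 / 2 := by
    intro n
    obtain ⟨u, h1, h2⟩ := hT (r n) (hr n)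
    have e : inner ℂ (f n) (r n) = inner ℂ (g n) (u : H) - inner ℂ (f n) (T u - r n) := by
      rw [← hfg, inner_sub_right]
      ring
    rw [e]
    refine (norm_sub_le _ _).trans (add_le_add ?_ ?_)
    · refine (norm_inner_le_norm _ _).trans (mul_le_mul_of_nonneg_left ?_ (norm_nonneg _))
      exact h2.trans (by simpa using mul_le_mul_of_nonneg_left (hr' n) hC)
    · refine (norm_inner_le_norm _ _).trans ?_
      have := mul_le_mul (hf n) h1 (norm_nonneg _) zero_le_one
      linarith [hr' n]
  have h1 : Tendsto (fun n => ‖g n‖ * C + 1 / 2) atTop (𝓝 (0 * C + 1 / 2)) :=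
    (hg.mul_const C).add_const _
  have := le_of_tendsto_of_tendsto' hfr h1 key
  norm_num at this

theorem not_hasClosedRange_of_mem_range [CompleteSpace R] {T : D →ₗ[ℂ] R} {f : ℕ → R}
    {g : ℕ → H} (hfg : ∀ n (u : D), inner ℂ (f n) (T u) = inner ℂ (g n) (u : H))
    (hf : ∀ n, ‖f n‖ = 1) (hg : Tendsto (fun n => ‖g n‖) atTop (𝓝 0))
    (hr : ∀ n, f n ∈ LinearMap.range T) : ¬ HasClosedRange T := by
  refine not_hasClosedRange_of_tendsto hfg (fun n => (hf n).le) hg hr (fun n => (hf n).le) ?_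
  have h1 : ∀ n, ‖inner ℂ (f n) (f n)‖ = 1 := by
    intro n
    rw [inner_self_eq_norm_sq_to_K, hf n]
    simp
  simp_rw [h1]
  exact tendsto_const_nhds

/-- A closed subspace of a Hilbert space is its own double orthogonal complement. -/
theorem HasClosedRange.mem_range [CompleteSpace R] {T : D →ₗ[ℂ] R} (h : HasClosedRange T) {f : R}
    (hf : ∀ v : R, (∀ u, inner ℂ (T u) v = 0) → inner ℂ f v = 0) : f ∈ LinearMap.range T := by
  have : CompleteSpace (LinearMap.range T) := h.completeSpace_coe
  rw [← Submodule.orthogonal_orthogonal (LinearMap.range T), Submodule.mem_orthogonal']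
  intro v hv
  rw [Submodule.mem_orthogonal] at hv
  exact hf v fun u => hv _ (LinearMap.mem_range_self _ _)

/-- The orthogonal complement of the range is isomorphic to the cokernel, hence finite-dimensional,
and the weakly null `f n` have projections onto it tending to `0`. The projections of `f n` onto the
range then serve as the vectors `r n` of `not_hasClosedRange_of_tendsto`. -/
theorem not_hasClosedRange_of_finite_cokernel [CompleteSpace R] {T : D →ₗ[ℂ] R} {f : ℕ → R}
    {g : ℕ → H} (hfg : ∀ n (u : D), inner ℂ (f n) (T u) = inner ℂ (g n) (u : H))
    (hf : Orthonormal ℂ f) (hg : Tendsto (fun n => ‖g n‖) atTop (𝓝 0))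
    (hc : HasFiniteCokernel T) : ¬ HasClosedRange T := by
  intro h
  have : CompleteSpace (LinearMap.range T) := h.completeSpace_coe
  let K := LinearMap.range T
  have hK : IsCompl K Kᗮ := Submodule.isCompl_orthogonal K
  have : FiniteDimensional ℂ (R ⧸ K) := hc
  have : FiniteDimensional ℂ Kᗮ := (Submodule.quotientEquivOfIsCompl K Kᗮ hK).finiteDimensional
  have hw : Tendsto (fun n => ‖Kᗮ.starProjection (f n)‖) atTop (𝓝 0) := by
    refine tendsto_norm_starProjection_of_finiteDimensional (fun v => ?_) _
    have := (hf.tendsto_inner_zero v).star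
    simpa using this
  refine not_hasClosedRange_of_tendsto (r := fun n => K.starProjection (f n)) hfg
    (fun n => (hf.1 n).le) hg (fun n => K.starProjection_apply_mem (f n))
    (fun n => (K.norm_starProjection_apply_le _).trans (hf.1 n).le) ?_ h
  have e : ∀ n, inner ℂ (f n) (K.starProjection (f n)) = 1 - inner ℂ (f n) (Kᗮ.starProjection (f n)) := by
    intro n
    rw [Submodule.starProjection_orthogonal_val, inner_sub_right, inner_self_eq_norm_sq_to_K, hf.1 n]
    simp
  have h0 : Tendsto (fun n => inner ℂ (f n) (Kᗮ.starProjection (f n))) atTop (𝓝 0) := by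
    refine squeeze_zero_norm (fun n => ?_) hw
    have := norm_inner_le_norm (𝕜 := ℂ) (f n) (Kᗮ.starProjection (f n))
    rwa [hf.1 n, one_mul] at this
  have h1 := (tendsto_const_nhds (x := (1 : ℂ))).sub h0
  simp_rw [e]
  simpa using h1.norm

theorem HasBoundedInverse.isFredholm {T : D →ₗ[ℂ] R} (h : HasBoundedInverse T) :
    IsFredholm T := by
  have hk : LinearMap.ker T = ⊥ := LinearMap.ker_eq_bot.2 h.1.1
  have hr : LinearMap.range T = ⊤ := LinearMap.range_eq_top.2 h.1.2
  unfold IsFredholm HasClosedRange HasFiniteKernel HasFiniteCokernel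
  rw [hk, hr]
  exact ⟨isClosed_univ, inferInstance, inferInstance⟩

end HilbertSpace

namespace OperatorPencil

variable {Ω H R : Type*} [NormedAddCommGroup H] [InnerProductSpace ℂ H]
  [NormedAddCommGroup R] [InnerProductSpace ℂ R] {P : OperatorPencil Ω H R} {ω : Ω}

theorem mem_essSpectrum_of_not_isSemiFredholm (h : ¬ IsSemiFredholm (P.op ω 1)) :
    ω ∈ P.spectrum ∧ ω ∈ P.essSpectrum1 ∧ ω ∈ P.essSpectrum2 ∧ ω ∈ P.essSpectrum3 ∧
      ω ∈ P.essSpectrum4 ∧ ω ∈ P.essSpectrum5 := by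
  have hF : ¬ IsFredholm (P.op ω 1) := fun hF => h ⟨hF.1, Or.inl hF.2.1⟩
  refine ⟨fun hb => ?_, h, fun h2 => h h2.1, hF, fun h4 => hF h4.1, fun h5 => ?_⟩
  · exact hF (HasBoundedInverse.isFredholm hb)
  -- `connectedComponentIn` is empty unless its base point, here `1`, lies in the set.
  · obtain ⟨μ, hμ, -⟩ := h5
    have := connectedComponentIn_nonempty_iff.1 ⟨μ, hμ⟩
    exact h this

end OperatorPencil

namespace Maxwell2D

open scoped ComplexConjugate

/-! ### Liouville's theorem for square-integrable harmonic fields -/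

open scoped Convolution in
-- As a function of the translation, the pairing is the convolution of `φ` with the reflected
-- component `t ↦ u (-t) j`, so the derivative falls on `φ`.
theorem hasFDerivAt_pairing_translate (u : L2) (j : Fin 3) {φ : Plane → ℂ} (h : IsTest φ)
    (x : Plane) : ∃ F' : Plane →L[ℝ] ℂ,
      HasFDerivAt (fun x => pairing u j (fun y => φ (y + x))) F' x ∧
      ∀ i, F' (EuclideanSpace.single i 1) = pairing u j (fun y => pd i φ (y + x)) := by
  let g : Plane → ℂ := fun t => u (-t) j
  have hg : LocallyIntegrable g volume :=
    ((memLp_comp u j).comp_measurePreserving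
      (Measure.measurePreserving_neg (volume : Measure Plane))).locallyIntegrable (by norm_num)
  have key : ∀ (ψ : Plane → ℂ) (x : Plane),
      (g ⋆[ContinuousLinearMap.mul ℝ ℂ, volume] ψ) x = pairing u j (fun y => ψ (y + x)) := by
    intro ψ x
    unfold pairing
    rw [← integral_neg_eq_self]
    simp only [convolution_def, ContinuousLinearMap.mul_apply', g]
    congr 1
    funext t
    rw [neg_add_eq_sub]
  refine ⟨(g ⋆[(ContinuousLinearMap.mul ℝ ℂ).precompR Plane, volume] fderiv ℝ φ) x, ?_,
    fun i => ?_⟩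
  · have := h.2.hasFDerivAt_convolution_right (ContinuousLinearMap.mul ℝ ℂ) hg
      (h.1.of_le (by norm_cast)) x
    have e : (g ⋆[ContinuousLinearMap.mul ℝ ℂ, volume] φ) =
      fun x => pairing u j (fun y => φ (y + x)) := funext fun x => key φ x
    rwa [e] at this
  · rw [convolution_precompR_apply (L := ContinuousLinearMap.mul ℝ ℂ) hg
      (h.2.fderiv (𝕜 := ℝ)) ((h.1.continuous_fderiv (by simp)))]
    exact key (pd i φ) x

theorem norm_testField_translate (j : Fin 3) {φ : Plane → ℂ} (h : IsTest φ) (a : Plane) :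
    ‖testField j _ (h.translate a)‖ = ‖testField j φ h‖ := by
  refine (sq_eq_sq₀ (norm_nonneg _) (norm_nonneg _)).1 ?_
  rw [norm_sq_testField, norm_sq_testField]
  exact integral_add_right_eq_self (fun x => ‖φ x‖ ^ 2) a

theorem norm_pairing_translate_le (u : L2) (j : Fin 3) {φ : Plane → ℂ} (h : IsTest φ) (a : Plane) :
    ‖pairing u j (fun y => φ (y + a))‖ ≤ ‖testField j _ h.conjugate‖ * ‖u‖ := by
  rw [pairing_eq_inner j (h.translate a), ← norm_testField_translate j h.conjugate a]
  exact norm_inner_le_norm _ _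

theorem tendsto_pairing_translate (u : L2) (j : Fin 3) {φ : Plane → ℂ} (h : IsTest φ) :
    ∃ a : ℕ → ℝ, Tendsto (fun n => pairing u j
      (fun y => φ (y + a n • EuclideanSpace.single 0 1))) atTop (𝓝 0) := by
  obtain ⟨r, hr0, hr⟩ : ∃ r : ℝ, 0 < r ∧ ∀ x, φ x ≠ 0 → ‖x‖ < r := by
    obtain ⟨r, hr0, hr⟩ := h.2.isBounded.exists_pos_norm_lt
    exact ⟨r, hr0, fun x hx => hr x (subset_tsupport _ hx)⟩
  -- Steps of twice the radius of the support make the translates disjoint, hence orthogonal and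
  -- weakly null.
  let a : ℕ → Plane := fun n => ((2 * r) * n) • EuclideanSpace.single 0 1
  refine ⟨fun n => (2 * r) * n, ?_⟩
  refine (tendsto_inner_zero_of_orthogonal (fun n => norm_testField_translate j h.conjugate (a n))
    (fun m n hmn => ?_) u).congr fun n => (pairing_eq_inner j (h.translate (a n)) u).symm
  refine inner_testField_of_disjoint _ _ _ _ fun x => ?_
  by_contra hx
  have h1 : ‖x + a m‖ < r := hr _ (by simpa using left_ne_zero_of_mul hx)
  have h2 : ‖x + a n‖ < r := hr _ (by simpa using right_ne_zero_of_mul hx)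
  have h3 : ‖a m - a n‖ < 2 * r := by
    have : a m - a n = (x + a m) - (x + a n) := by abel
    rw [this]
    exact (norm_sub_le _ _).trans_lt (by linarith)
  have h4 : ‖a m - a n‖ = 2 * r * |(m : ℝ) - n| := by
    simp only [a]
    rw [← sub_smul, norm_smul, ← mul_sub]
    simp [abs_of_pos hr0]
  have h5 : (1 : ℝ) ≤ |(m : ℝ) - n| := by
    have : (1 : ℤ) ≤ |(m : ℤ) - n| := Int.one_le_abs (by omega)
    exact_mod_cast this
  rw [h4] at h3
  nlinarith

/-- The pairing with translates of `φ` is bounded by Cauchy–Schwarz and, by hypothesis, entire in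
the complex translation parameter. Liouville makes it constant, and it tends to `0` along far
translations. The sign of `s` chooses between `z` and its conjugate. -/
theorem pairing_eq_zero_of_cauchyRiemann (u : L2) (j : Fin 3) {φ : Plane → ℂ} (h : IsTest φ)
    (s : ℝ) (hs : ∀ x, pairing u j (fun y => pd 0 φ (y + x)) +
      s * Complex.I * pairing u j (fun y => pd 1 φ (y + x)) = 0) :
    pairing u j φ = 0 := by
  let F : Plane → ℂ := fun x => pairing u j (fun y => φ (y + x))
  -- `T z = (re z, s · im z)`; for this choice the hypothesis is the Cauchy–Riemann equation of `F ∘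
  -- T`.
  let T : ℂ →L[ℝ] Plane := Complex.reCLM.smulRight (EuclideanSpace.single 0 1) +
    (s • Complex.imCLM).smulRight (EuclideanSpace.single 1 1)
  have hd : Differentiable ℂ (fun z => F (T z)) := by
    intro z
    obtain ⟨F', hF, hF'⟩ := hasFDerivAt_pairing_translate u j h (T z)
    have hc : HasFDerivAt (fun z => F (T z)) (F'.comp T) z := hF.comp z T.hasFDerivAt
    rw [differentiableAt_complex_iff_differentiableAt_real]
    refine ⟨hc.differentiableAt, ?_⟩
    rw [hc.fderiv]
    have h1 : F' (T 1) = pairing u j (fun y => pd 0 φ (y + T z)) := by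
      rw [← hF' 0]
      simp [T]
    have h2 : F' (T Complex.I) = s * pairing u j (fun y => pd 1 φ (y + T z)) := by
      rw [← hF' 1]
      simp [T]
    simp only [ContinuousLinearMap.comp_apply, h1, h2, smul_eq_mul]
    linear_combination (-Complex.I) * hs (T z) + s * pairing u j (fun y => pd 1 φ (y + T z)) * Complex.I_sq
  have hb : Bornology.IsBounded (Set.range fun z => F (T z)) := by
    refine (Metric.isBounded_closedBall (x := (0 : ℂ))
      (r := ‖testField j _ h.conjugate‖ * ‖u‖)).subset ?_
    rintro _ ⟨z, rfl⟩
    simpa using norm_pairing_translate_le u j h (T z)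
  obtain ⟨a, ha⟩ := tendsto_pairing_translate u j h
  have hconst : ∀ n, pairing u j (fun y => φ (y + a n • EuclideanSpace.single 0 1)) =
      pairing u j φ := by
    intro n
    have := hd.apply_eq_apply_of_bounded hb (a n : ℂ) 0
    simpa [F, T] using this
  simp_rw [hconst] at ha
  exact tendsto_nhds_unique tendsto_const_nhds ha

/-- The Laplacian factors as `(∂₁ + i ∂₂)(∂₁ - i ∂₂)`, and each factor is removed by one use of
`pairing_eq_zero_of_cauchyRiemann`. -/
theorem pairing_eq_zero_of_harmonic (u : L2) (j : Fin 3)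
    (hu : ∀ φ, IsTest φ → pairing u j (lap φ) = 0) {φ : Plane → ℂ} (h : IsTest φ) :
    pairing u j φ = 0 := by
  have h1 : ∀ ψ, IsTest ψ → pairing u j (pd 0 ψ) = Complex.I * pairing u j (pd 1 ψ) := by
    intro ψ hψ
    have hI := (hψ.pd 1).const_mul Complex.I
    have := pairing_eq_zero_of_cauchyRiemann u j ((hψ.pd 0).sub hI) 1 fun x => by
      have ht := hu _ (hψ.translate x)
      unfold lap at ht
      simp only [pd_translate] at ht
      rw [pairing_fun_add _ _ (((hψ.pd 0).pd 0).translate x) (((hψ.pd 1).pd 1).translate x)] at ht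
      simp only [pd_sub _ (hψ.pd 0) hI, pd_const_mul _ (hψ.pd 1)]
      rw [pairing_fun_sub _ _ (((hψ.pd 0).pd 0).translate x)
          ((((hψ.pd 1).pd 0).translate x).const_mul _),
        pairing_fun_sub _ _ (((hψ.pd 0).pd 1).translate x)
          ((((hψ.pd 1).pd 1).translate x).const_mul _),
        pairing_const_mul, pairing_const_mul, pd_comm hψ]
      push_cast
      linear_combination ht - pairing u j (fun y => pd 1 (pd 1 ψ) (y + x)) * Complex.I_sq
    rw [pairing_fun_sub _ _ (hψ.pd 0) hI, pairing_const_mul] at this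
    exact sub_eq_zero.1 this
  refine pairing_eq_zero_of_cauchyRiemann u j h (-1) fun x => ?_
  have := h1 _ (h.translate x)
  simp only [pd_translate] at this
  push_cast
  linear_combination this

/-- Cross-differentiating the two equations makes each component harmonic. The components may come
from different fields, because the reflection argument combines an even part of one with an odd part
of the other. -/
theorem pairing_eq_zero_of_divFree_curlFree (u v : L2) (j k : Fin 3)
    (hdiv : ∀ φ, IsTest φ → pairing u j (pd 0 φ) + pairing v k (pd 1 φ) = 0)
    (hcurl : ∀ φ, IsTest φ → pairing v k (pd 0 φ) = pairing u j (pd 1 φ))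
    {φ : Plane → ℂ} (h : IsTest φ) : pairing u j φ = 0 ∧ pairing v k φ = 0 := by
  refine ⟨pairing_eq_zero_of_harmonic u j (fun ψ hψ => ?_) h,
    pairing_eq_zero_of_harmonic v k (fun ψ hψ => ?_) h⟩
  · have h1 := hdiv _ (hψ.pd 0)
    have h2 := hcurl _ (hψ.pd 1)
    rw [← pd_comm hψ] at h1
    have e : pairing u j (lap ψ) = _ :=
      pairing_fun_add u j ((hψ.pd 0).pd 0) ((hψ.pd 1).pd 1)
    rw [e]
    linear_combination h1 - h2
  · have h1 := hdiv _ (hψ.pd 1)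
    have h2 := hcurl _ (hψ.pd 0)
    rw [← pd_comm hψ] at h2
    have e : pairing v k (lap ψ) = _ :=
      pairing_fun_add v k ((hψ.pd 0).pd 0) ((hψ.pd 1).pd 1)
    rw [e]
    linear_combination h1 + h2

theorem hasWeakCurl_zero_right {G : L2} (hdiv : IsDivFree G) (h : HasWeakCurl G 0) : G = 0 := by
  have h' := fun φ hφ => h φ hφ
  simp only [pairing_zero] at h'
  refine eq_zero_of_pairing fun j φ hφ => ?_
  have h01 := pairing_eq_zero_of_divFree_curlFree G G 0 1 hdiv
    (fun ψ hψ => by linear_combination (h' ψ hψ).2.2) hφ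
  fin_cases j
  · exact h01.1
  · exact h01.2
  · refine pairing_eq_zero_of_harmonic G 2 (fun ψ hψ => ?_) hφ
    have e : pairing G 2 (lap ψ) = _ :=
      pairing_fun_add G 2 ((hψ.pd 0).pd 0) ((hψ.pd 1).pd 1)
    rw [e]
    linear_combination -(h' _ (hψ.pd 0)).2.1 + (h' _ (hψ.pd 1)).1

/-! ### Dilated test functions in a half-plane -/

/-- In dimension two the factor `t` exactly compensates the Jacobian `t⁻²` in the squared norm. -/
theorem norm_testField_dilate (j : Fin 3) {φ : Plane → ℂ} (h : IsTest φ) {t : ℝ} (ht : 0 < t) :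
    ‖testField j _ ((h.dilate ht.ne').const_mul (t : ℂ))‖ = ‖testField j φ h‖ := by
  refine (sq_eq_sq₀ (norm_nonneg _) (norm_nonneg _)).1 ?_
  rw [norm_sq_testField, norm_sq_testField]
  have e : ∀ x : Plane, ‖(t : ℂ) * φ (t • x)‖ ^ 2 = t ^ 2 * ‖φ (t • x)‖ ^ 2 := by
    intro x
    rw [norm_mul, mul_pow, Complex.norm_real, Real.norm_eq_abs, sq_abs]
  simp_rw [e]
  rw [integral_const_mul, Measure.integral_comp_smul volume (fun x => ‖φ x‖ ^ 2) t]
  simp only [finrank_euclideanSpace, Fintype.card_fin, smul_eq_mul]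
  rw [abs_of_pos (by positivity), mul_inv_cancel_left₀ (by positivity)]

theorem exists_test_in_halfPlane (s : ℝ) (hs : |s| = 1) :
    ∃ (φ : Plane → ℂ) (h : IsTest φ), ‖testField 2 φ h‖ = 1 ∧
      ∀ x, φ x ≠ 0 → 1 ≤ s * x 0 ∧ s * x 0 ≤ 3 := by
  have hs2 : s * s = 1 := by rw [← abs_mul_abs_self, hs, one_mul]
  let c : Plane := EuclideanSpace.single 0 (2 * s)
  let f : ContDiffBump c := ⟨1 / 2, 1, by norm_num, by norm_num⟩
  have h : IsTest fun x => (f x : ℂ) :=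
    ⟨Complex.ofRealCLM.contDiff.comp f.contDiff,
      f.hasCompactSupport.comp_left (g := fun r : ℝ => (r : ℂ)) (by simp)⟩
  have hN : ‖testField 2 _ h‖ ≠ 0 := by
    intro h0
    have := congrFun (eq_zero_of_testField_eq_zero 2 h (norm_eq_zero.1 h0)) c
    simp [f.one_of_mem_closedBall (Metric.mem_closedBall_self f.rIn_pos.le)] at this
  refine ⟨_, h.const_mul ((‖testField 2 _ h‖⁻¹ : ℝ) : ℂ), ?_, fun x hx => ?_⟩
  · rw [testField_const_mul 2 h, norm_smul, Complex.norm_real, Real.norm_eq_abs,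
      abs_of_nonneg (by positivity), inv_mul_cancel₀ hN]
  · have hx' : x ∈ Function.support f := by
      have := right_ne_zero_of_mul hx
      simpa using this
    rw [f.support_eq, mem_ball_iff_norm] at hx'
    have h1 : |x 0 - 2 * s| < 1 := by
      have := PiLp.norm_apply_le (x - c) 0
      simp only [PiLp.sub_apply, c, PiLp.single_apply, if_true, Real.norm_eq_abs] at this
      exact this.trans_lt hx'
    have h2 : |s * x 0 - 2| < 1 := by
      have : s * x 0 - 2 = s * (x 0 - 2 * s) := by linear_combination (2 : ℝ) * hs2
      rw [this, abs_mul, hs, one_mul]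
      exact h1
    rw [abs_lt] at h2
    constructor <;> linarith

theorem exists_test_sequence (s : ℝ) (hs : |s| = 1) :
    ∃ (φ : ℕ → Plane → ℂ) (h : ∀ n, IsTest (φ n)), (∀ n, ‖testField 2 _ (h n)‖ = 1) ∧
      (∀ n, tsupport (φ n) ⊆ {x | 0 < s * x 0}) ∧
      (∀ m n, m ≠ n → Disjoint (tsupport (φ m)) (tsupport (φ n))) ∧
      Tendsto (fun n => ‖testField 2 _ (h n).lap.neg‖) atTop (𝓝 0) := by
  obtain ⟨ρ, hρ, hN, hsupp⟩ := exists_test_in_halfPlane s hs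
  -- On the support of the profile `s x₁` lies in `[1, 3]`; since `3 < 4`, dilation by powers of `1
  -- / 4` moves these strips apart.
  let t : ℕ → ℝ := fun n => (1 / 4) ^ n
  have ht : ∀ n, 0 < t n := fun n => by positivity
  have hts : ∀ n, tsupport (fun x => (t n : ℂ) * ρ (t n • x)) ⊆
      {x | 1 ≤ t n * (s * x 0) ∧ t n * (s * x 0) ≤ 3} := by
    intro n
    refine closure_minimal (fun x hx => ?_) ?_
    · have := hsupp _ (right_ne_zero_of_mul hx)
      simp only [PiLp.smul_apply, smul_eq_mul] at this
      exact ⟨by linarith [this.1], by linarith [this.2]⟩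
    · have hc : Continuous fun x : Plane => t n * (s * x 0) := by fun_prop
      exact (isClosed_le continuous_const hc).inter (isClosed_le hc continuous_const)
  have hlt : ∀ m n, m < n → Disjoint (tsupport fun x => (t m : ℂ) * ρ (t m • x))
      (tsupport fun x => (t n : ℂ) * ρ (t n • x)) := by
    intro m n hmn
    refine Set.disjoint_left.2 fun x hm hn => ?_
    have h1 := hts m hm
    have h2 := hts n hn
    simp only [Set.mem_ofPred_eq] at h1 h2
    have hle : t n ≤ t m / 4 := by
      have : t n ≤ t (m + 1) := pow_le_pow_of_le_one (by norm_num) (by norm_num) hmn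
      refine this.trans (le_of_eq ?_)
      simp only [t, pow_succ]
      ring
    have hpos : 0 < s * x 0 := by
      by_contra hneg
      have := mul_nonneg (ht n).le (neg_nonneg.2 (not_lt.1 hneg))
      linarith [h2.1]
    have := mul_le_mul_of_nonneg_right hle hpos.le
    linarith [h1.2, h2.1]
  refine ⟨fun n x => (t n : ℂ) * ρ (t n • x), fun n => (hρ.dilate (ht n).ne').const_mul _,
    fun n => ?_, fun n x hx => ?_, fun m n hmn => ?_, ?_⟩
  · exact (norm_testField_dilate 2 hρ (ht n)).trans hN
  · have := (hts n hx).1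
    by_contra hneg
    have := mul_nonneg (ht n).le (neg_nonneg.2 (not_lt.1 hneg))
    linarith
  · rcases lt_or_gt_of_ne hmn with h | h
    · exact hlt m n h
    · exact (hlt n m h).symm
  · have hlap : ∀ n, ‖testField 2 _ ((hρ.dilate (ht n).ne').const_mul (t n : ℂ)).lap.neg‖ =
        (t n) ^ 2 * ‖testField 2 _ hρ.lap‖ := by
      intro n
      have e : (fun x => -lap (fun x => (t n : ℂ) * ρ (t n • x)) x) =
          fun x => (-(t n : ℂ) ^ 2) * ((t n : ℂ) * lap ρ (t n • x)) := by
        rw [lap_const_mul (hρ.dilate (ht n).ne'), lap_dilate hρ (ht n).ne']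
        funext x
        ring
      have h1 := (hρ.lap.dilate (ht n).ne').const_mul (t n : ℂ)
      have e1 := testField_congr 2 ((hρ.dilate (ht n).ne').const_mul (t n : ℂ)).lap.neg
        (h1.const_mul (-(t n : ℂ) ^ 2)) e
      have e2 := testField_const_mul 2 h1 (-(t n : ℂ) ^ 2)
      refine (congrArg norm (e1.trans e2)).trans ?_
      refine (norm_smul _ _).trans (congrArg₂ (· * ·) ?_ (norm_testField_dilate 2 hρ.lap (ht n)))
      simp
    simp_rw [hlap]
    have h0 : Tendsto t atTop (𝓝 0) := tendsto_pow_atTop_nhds_zero_of_lt_one (by norm_num) (by norm_num)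
    simpa using (h0.pow 2).mul_const ‖testField 2 _ hρ.lap‖

/-! ### The action of the pencil on test fields -/

theorem coeFn_mulStep (a b : ℂ) (u : L2) :
    mulStep a b u =ᵐ[volume] fun x => step a b x • u x :=
  MemLp.coeFn_toLp (memLp_step_smul a b u)

theorem pairing_mulStep (a b : ℂ) (u : L2) (j : Fin 3) (φ : Plane → ℂ) :
    pairing (mulStep a b u) j φ = ∫ x, step a b x * u x j * φ x := by
  unfold pairing
  refine integral_congr_ae ?_
  filter_upwards [coeFn_mulStep a b u] with x hx
  simp [hx]

theorem pairing_mulStep_eq_zero {a b : ℂ} (u : L2) (j : Fin 3) {φ : Plane → ℂ}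
    (hφ : ∀ x, step a b x * φ x = 0) : pairing (mulStep a b u) j φ = 0 := by
  rw [pairing_mulStep, ← integral_zero Plane ℂ]
  congr 1
  funext x
  linear_combination u x j * hφ x

theorem mulStep_testField {a b : ℂ} (j : Fin 3) {φ : Plane → ℂ} (h : IsTest φ)
    (hφ : ∀ x, step a b x * φ x = 0) : mulStep a b (testField j φ h) = 0 := by
  refine (Lp.eq_zero_iff_ae_eq_zero).2 ?_
  filter_upwards [coeFn_mulStep a b (testField j φ h), coeFn_testField j h] with x hx hx'
  rw [hx, hx']
  ext k
  by_cases hk : k = j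
  · simpa [hk] using hφ x
  · simp [hk]

theorem pairing_mulStep_testField_of_ne (a b : ℂ) {j k : Fin 3} (hjk : k ≠ j) {φ : Plane → ℂ}
    (h : IsTest φ) (ψ : Plane → ℂ) : pairing (mulStep a b (testField j φ h)) k ψ = 0 := by
  rw [pairing_mulStep, ← integral_zero Plane ℂ]
  refine integral_congr_ae ?_
  filter_upwards [coeFn_testField j h] with x hx
  simp [hx, hjk]

theorem testField_two_mem_domain (a b : ℂ) {φ : Plane → ℂ} (h : IsTest φ) :
    testField 2 φ h ∈ domain a b := by
  refine ⟨⟨_, _, hasWeakCurl_testField_two h, hasWeakCurl_curl_testField_two h⟩, fun ψ _ => ?_⟩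
  rw [pairing_mulStep_testField_of_ne _ _ (by decide),
    pairing_mulStep_testField_of_ne _ _ (by decide), add_zero]

theorem testField_two_mem_rangeSpace {φ : Plane → ℂ} (h : IsTest φ) :
    testField 2 φ h ∈ rangeSpace := by
  intro ψ _
  rw [pairing_testField_of_ne _ _ _ (by decide), pairing_testField_of_ne _ _ _ (by decide),
    add_zero]

/-- The operator `E ↦ ∇ × ∇ × E - c w E`. -/
def maxwellOp (c a b : ℂ) : domain a b →ₗ[ℂ] rangeSpace :=
  curlCurl a b - (1 : ℂ) • mulCoeff c a b

theorem coe_maxwellOp (c a b : ℂ) (E : domain a b) {G F : L2} (h1 : HasWeakCurl E G)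
    (h2 : HasWeakCurl G F) :
    (maxwellOp c a b E : L2) = F - mulStep (c * a) (c * b) E := by
  have e := curlCurlFun_eq E h1 h2
  rw [← e, ← one_smul ℂ (mulStep (c * a) (c * b) (E : L2))]
  rfl

theorem coe_maxwellOp_mk (c a b : ℂ) {E G F : L2} (hE : E ∈ domain a b) (h1 : HasWeakCurl E G)
    (h2 : HasWeakCurl G F) :
    (maxwellOp c a b ⟨E, hE⟩ : L2) = F - mulStep (c * a) (c * b) E :=
  coe_maxwellOp c a b ⟨E, hE⟩ h1 h2

theorem coe_maxwellOp_testField (c a b : ℂ) {φ : Plane → ℂ} (h : IsTest φ)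
    (hφ : ∀ x, step (c * a) (c * b) x * φ x = 0) :
    (maxwellOp c a b ⟨testField 2 φ h, testField_two_mem_domain a b h⟩ : L2) =
      testField 2 _ h.lap.neg := by
  rw [coe_maxwellOp_mk c a b _ (hasWeakCurl_testField_two h) (hasWeakCurl_curl_testField_two h),
    mulStep_testField 2 h hφ, sub_zero]

/-- Two integrations by parts move the curls onto `φ`, and the term with the coefficient drops out
because `φ` lives where the coefficient vanishes. -/
theorem inner_testField_maxwellOp (c a b : ℂ) {φ : Plane → ℂ} (h : IsTest φ)
    (hφ : ∀ x, step (c * a) (c * b) x * φ x = 0) (E : domain a b) :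
    inner ℂ (testField 2 φ h) (maxwellOp c a b E : L2) =
      inner ℂ (testField 2 _ h.lap.neg) (E : L2) := by
  obtain ⟨F, G, h1, h2⟩ := exists_curlCurl E
  have hc := h.conjugate
  rw [coe_maxwellOp c a b E h1 h2, inner_testField, inner_testField, pairing_sub _ _ _ hc,
    pairing_mulStep_eq_zero, sub_zero, (h2 _ hc).2.2, (h1 _ (hc.pd 0)).2.1, (h1 _ (hc.pd 1)).1]
  · have e : (fun x => conj (-lap φ x)) = fun x => -lap (fun x => conj (φ x)) x := by
      rw [lap_conj h]
      simp
    rw [e, pairing_fun_neg]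
    have e2 : pairing (E : L2) 2 (lap fun x => conj (φ x)) = _ :=
      pairing_fun_add (E : L2) 2 ((hc.pd 0).pd 0) ((hc.pd 1).pd 1)
    rw [e2]
    ring
  · intro x
    rcases mul_eq_zero.1 (hφ x) with h0 | h0 <;> simp [h0]

/-- A gradient is curl-free, and one supported where the coefficient is zero is annihilated by it,
so both the constraint and the equation hold trivially. -/
theorem gradient_mem_ker (c a b : ℂ) {φ : Plane → ℂ} (h : IsTest φ)
    (hφ : ∀ i x, step a b x * pd i φ x = 0) :
    ∃ E : domain a b, (E : L2) = testField 0 _ (h.pd 0) + testField 1 _ (h.pd 1) ∧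
      maxwellOp c a b E = 0 := by
  have hm : mulStep a b (testField 0 _ (h.pd 0) + testField 1 _ (h.pd 1)) = 0 := by
    rw [map_add, mulStep_testField _ _ (hφ 0), mulStep_testField _ _ (hφ 1), add_zero]
  have hdiv : mulStep a b (testField 0 _ (h.pd 0) + testField 1 _ (h.pd 1)) ∈ rangeSpace := by
    rw [hm]
    exact rangeSpace.zero_mem
  refine ⟨⟨_, ⟨0, 0, hasWeakCurl_gradient h, HasWeakCurl.zero⟩, hdiv⟩, rfl, Subtype.ext ?_⟩
  refine (coe_maxwellOp_mk c a b _ (hasWeakCurl_gradient h) HasWeakCurl.zero).trans ?_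
  rw [mulStep_mul, hm, smul_zero, sub_zero]
  rfl

theorem step_mul_eq_zero {a b : ℂ} (s : ℝ) (hs : (s = 1 ∧ a = 0) ∨ (s = -1 ∧ b = 0))
    {f : Plane → ℂ} {x : Plane} (hf : ¬ 0 < s * x 0 → f x = 0) : step a b x * f x = 0 := by
  unfold step
  rcases hs with ⟨rfl, rfl⟩ | ⟨rfl, rfl⟩
  · split_ifs with hx
    · simp
    · rw [hf (by simpa using hx), mul_zero]
  · split_ifs with hx
    · rw [hf (by linarith), mul_zero]
    · simp

theorem eq_zero_of_pd_eq_zero {φ : Plane → ℂ} (h : IsTest φ) (h0 : ∀ i, pd i φ = 0) : φ = 0 := by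
  have hf : ∀ x, fderiv ℝ φ x = 0 := by
    intro x
    ext v
    have hv : v = v 0 • EuclideanSpace.single 0 1 + v 1 • EuclideanSpace.single 1 1 := by
      ext i
      fin_cases i <;> simp
    have e0 : fderiv ℝ φ x (EuclideanSpace.single 0 1) = 0 := congrFun (h0 0) x
    have e1 : fderiv ℝ φ x (EuclideanSpace.single 1 1) = 0 := congrFun (h0 1) x
    rw [hv, map_add, map_smul, map_smul, e0, e1]
    simp
  by_contra hne
  obtain ⟨x, hx⟩ := Function.ne_iff.1 hne
  -- A nonzero constant has the whole plane as support, which is not compact.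
  have hsupp : tsupport φ = Set.univ := by
    refine Set.eq_univ_of_forall fun y => subset_tsupport _ ?_
    rw [Function.mem_support, is_const_of_fderiv_eq_zero h.differentiable hf y x]
    exact hx
  have := h.2.isCompact
  rw [hsupp] at this
  exact noncompact_univ Plane this

theorem not_finiteDimensional_of_linearIndependent {V : Type*} [AddCommGroup V] [Module ℂ V]
    {K : Submodule ℂ V} {u : ℕ → V} (hu : LinearIndependent ℂ u) (hK : ∀ n, u n ∈ K) :
    ¬ FiniteDimensional ℂ K := by
  intro hfin
  let v : ℕ → K := fun n => ⟨u n, hK n⟩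
  have hv : LinearIndependent ℂ v := LinearIndependent.of_comp K.subtype hu
  exact not_finite_iff_infinite.2 (inferInstance : Infinite ℕ) hv.finite

/-- Gradients of test functions with disjoint supports in the half-plane of zero coefficient are
orthogonal, and they are nonzero since only the zero test function is constant. -/
theorem not_hasFiniteKernel_of_eq_zero (c : ℂ) {a b : ℂ} (hab : a = 0 ∨ b = 0) :
    ¬ HasFiniteKernel (maxwellOp c a b) := by
  obtain ⟨s, hs, hs'⟩ : ∃ s : ℝ, |s| = 1 ∧ ((s = 1 ∧ a = 0) ∨ (s = -1 ∧ b = 0)) := by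
    rcases hab with h | h
    · exact ⟨1, by simp, Or.inl ⟨rfl, h⟩⟩
    · exact ⟨-1, by simp, Or.inr ⟨rfl, h⟩⟩
  obtain ⟨φ, h, hN, hsupp, hdisj, -⟩ := exists_test_sequence s hs
  have hgrad := fun n => gradient_mem_ker c a b (h n) fun i x =>
    step_mul_eq_zero s hs' (f := pd i (φ n)) (x := x) fun hx =>
      pd_eq_zero_of_notMem_tsupport i fun hx' => hx (hsupp n hx')
  choose E hE hE0 using hgrad
  have hd : ∀ i j m n, m ≠ n → ∀ x, pd i (φ m) x * pd j (φ n) x = 0 := by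
    intro i j m n hmn x
    by_cases hx : x ∈ tsupport (φ m)
    · rw [pd_eq_zero_of_notMem_tsupport j (Set.disjoint_left.1 (hdisj m n hmn) hx), mul_zero]
    · rw [pd_eq_zero_of_notMem_tsupport i hx, zero_mul]
  have hli : LinearIndependent ℂ fun n => (E n : L2) := by
    refine linearIndependent_of_ne_zero_of_inner_eq_zero (𝕜 := ℂ) (fun n h0 => ?_) fun m n hmn => ?_
    · rw [hE] at h0
      have hz : ∀ i, pd i (φ n) = 0 := by
        have hi : inner ℂ (testField 0 _ ((h n).pd 0)) (testField 1 _ ((h n).pd 1)) = 0 := by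
          rw [inner_testField]
          exact pairing_testField_of_ne _ _ _ (by decide)
        have := norm_add_sq_eq_norm_sq_add_norm_sq_of_inner_eq_zero (𝕜 := ℂ) _ _ hi
        rw [h0, norm_zero, mul_zero] at this
        have n0 := mul_self_nonneg ‖testField 0 _ ((h n).pd 0)‖
        have n1 := mul_self_nonneg ‖testField 1 _ ((h n).pd 1)‖
        have z0 := mul_self_eq_zero.1 (by linarith : ‖testField 0 _ ((h n).pd 0)‖ * _ = 0)
        have z1 := mul_self_eq_zero.1 (by linarith : ‖testField 1 _ ((h n).pd 1)‖ * _ = 0)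
        intro i
        fin_cases i
        · exact eq_zero_of_testField_eq_zero 0 ((h n).pd 0) (norm_eq_zero.1 z0)
        · exact eq_zero_of_testField_eq_zero 1 ((h n).pd 1) (norm_eq_zero.1 z1)
      have hφ := hN n
      have hsq := norm_sq_testField 2 (h n)
      rw [hφ, eq_zero_of_pd_eq_zero (h n) hz] at hsq
      simp at hsq
    · beta_reduce
      rw [hE, hE, inner_add_left, inner_add_right, inner_add_right]
      simp [inner_testField_of_disjoint, hd _ _ m n hmn]
  exact not_finiteDimensional_of_linearIndependent
    (LinearIndependent.of_comp (domain a b).subtype hli) hE0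

/-! ### Cutting off test functions at the interface -/

/-- A smooth function of `x₁` that vanishes for `n x₁ ≤ 1` and equals `1` for `2 ≤ n x₁`. -/
def cutoff (n : ℕ) (x : Plane) : ℂ := (Real.smoothTransition (n * x 0 - 1) : ℂ)

theorem contDiff_cutoff (n : ℕ) : ContDiff ℝ (⊤ : ℕ∞) (cutoff n) := by
  refine Complex.ofRealCLM.contDiff.comp (Real.smoothTransition.contDiff.comp ?_)
  fun_prop

theorem cutoff_eq_zero {n : ℕ} {x : Plane} (h : n * x 0 ≤ 1) : cutoff n x = 0 := by
  simp [cutoff, Real.smoothTransition.zero_of_nonpos (by linarith : (n * x 0 - 1 : ℝ) ≤ 0)]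

theorem cutoff_eq_one {n : ℕ} {x : Plane} (h : 2 ≤ n * x 0) : cutoff n x = 1 := by
  simp [cutoff, Real.smoothTransition.one_of_one_le (by linarith : (1 : ℝ) ≤ n * x 0 - 1)]

theorem norm_cutoff_le (n : ℕ) (x : Plane) : ‖cutoff n x‖ ≤ 1 := by
  rw [cutoff, Complex.norm_real, Real.norm_eq_abs, abs_of_nonneg (Real.smoothTransition.nonneg _)]
  exact Real.smoothTransition.le_one _

theorem exists_bound_deriv_smoothTransition :
    ∃ C, 0 ≤ C ∧ ∀ t, |deriv Real.smoothTransition t| ≤ C := by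
  have hc : Continuous (deriv Real.smoothTransition) :=
    (Real.smoothTransition.contDiff (n := 1)).continuous_deriv (by simp)
  obtain ⟨C, hC⟩ := (isCompact_Icc (a := (0 : ℝ)) (b := 1)).exists_bound_of_continuousOn hc.continuousOn
  have hC0 : 0 ≤ C := (norm_nonneg _).trans (hC 0 (by simp))
  refine ⟨C, hC0, fun t => ?_⟩
  by_cases ht : t ∈ Set.Icc (0 : ℝ) 1
  · exact hC t ht
  · have : deriv Real.smoothTransition t = 0 := by
      rw [Set.mem_Icc, not_and_or, not_le, not_le] at ht
      rcases ht with ht | ht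
      · have : Real.smoothTransition =ᶠ[𝓝 t] fun _ => 0 := by
          filter_upwards [Iio_mem_nhds ht] with y hy
          exact Real.smoothTransition.zero_of_nonpos (le_of_lt hy)
        rw [this.deriv_eq, deriv_const]
      · have : Real.smoothTransition =ᶠ[𝓝 t] fun _ => 1 := by
          filter_upwards [Ioi_mem_nhds ht] with y hy
          exact Real.smoothTransition.one_of_one_le (le_of_lt hy)
        rw [this.deriv_eq, deriv_const]
    rw [this, abs_zero]
    exact hC0

theorem pd_cutoff (i : Fin 2) (n : ℕ) (x : Plane) :
    pd i (cutoff n) x = ((deriv Real.smoothTransition (n * x 0 - 1) *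
      (n * (EuclideanSpace.single i (1 : ℝ) : Plane) 0) : ℝ) : ℂ) := by
  have h1 : HasFDerivAt (fun x : Plane => (n : ℝ) * x 0 - 1)
      ((n : ℝ) • (EuclideanSpace.proj 0 : Plane →L[ℝ] ℝ)) x :=
    (((EuclideanSpace.proj 0 : Plane →L[ℝ] ℝ).hasFDerivAt).const_mul (n : ℝ)).sub_const 1
  have h2 : HasDerivAt Real.smoothTransition (deriv Real.smoothTransition (n * x 0 - 1))
      (n * x 0 - 1) :=
    ((Real.smoothTransition.contDiff (n := 1)).differentiable (by simp) _).hasDerivAt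
  have h3 := Complex.ofRealCLM.hasFDerivAt.comp x (h2.comp_hasFDerivAt x h1)
  have h4 : HasFDerivAt (cutoff n) _ x := h3
  rw [pd, h4.fderiv]
  fin_cases i <;> simp

/-- The derivative of the cutoff is of size `n`, but only where `x₁` is at most `2 / n`; there the
linear vanishing of `φ` compensates it, uniformly in `n`. -/
theorem norm_pd_cutoff_mul_le {φ : Plane → ℂ} {K : ℝ} (hK : ∀ x, ‖φ x‖ ≤ K * |x 0|) :
    ∃ C, ∀ i n x, ‖pd i (cutoff n) x * φ x‖ ≤ C := by
  obtain ⟨C, hC0, hC⟩ := exists_bound_deriv_smoothTransition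
  have hK0 : 0 ≤ K := by
    have := (norm_nonneg _).trans (hK (EuclideanSpace.single 0 1))
    simpa using this
  refine ⟨C * (K * 2), fun i n x => ?_⟩
  by_cases hx : x 0 ≤ 0 ∨ 2 < n * x 0
  · have h0 : pd i (cutoff n) x = 0 := by
      rcases hx with hx | hx
      · have : cutoff n =ᶠ[𝓝 x] fun _ => 0 := by
          have ho : IsOpen {y : Plane | (n : ℝ) * y 0 < 1} := isOpen_lt (by fun_prop) (by fun_prop)
          filter_upwards [ho.mem_nhds (show (n : ℝ) * x 0 < 1 by
            have := mul_nonpos_of_nonneg_of_nonpos (Nat.cast_nonneg (α := ℝ) n) hx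
            linarith)] with y hy
          exact cutoff_eq_zero hy.le
        rw [pd_congr_of_eventuallyEq i this]
        simp [pd]
      · have : cutoff n =ᶠ[𝓝 x] fun _ => 1 := by
          have ho : IsOpen {y : Plane | 2 < (n : ℝ) * y 0} := isOpen_lt (by fun_prop) (by fun_prop)
          filter_upwards [ho.mem_nhds hx] with y hy
          exact cutoff_eq_one hy.le
        rw [pd_congr_of_eventuallyEq i this]
        simp [pd]
    rw [h0, zero_mul, norm_zero]
    positivity
  · push Not at hx
    have hs : |(EuclideanSpace.single i (1 : ℝ) : Plane) 0| ≤ 1 := by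
      have := PiLp.norm_apply_le (EuclideanSpace.single i (1 : ℝ) : Plane) 0
      simpa using this
    rw [pd_cutoff, norm_mul, Complex.norm_real, Real.norm_eq_abs, abs_mul, abs_mul, Nat.abs_cast,
      mul_assoc]
    refine mul_le_mul (hC _) ?_ (by positivity) hC0
    calc (n : ℝ) * |(EuclideanSpace.single i (1 : ℝ) : Plane) 0| * ‖φ x‖
        ≤ n * 1 * (K * |x 0|) := by
          gcongr
          exact hK x
      _ = K * (n * x 0) := by rw [abs_of_pos hx.1]; ring
      _ ≤ K * 2 := by gcongr; exact hx.2

theorem norm_le_abs_of_eq_zero {φ : Plane → ℂ} (h : IsTest φ) (h0 : ∀ x : Plane, x 0 = 0 → φ x = 0) :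
    ∃ K, ∀ x, ‖φ x‖ ≤ K * |x 0| := by
  obtain ⟨K, hK⟩ := ContDiff.lipschitzWith_of_hasCompactSupport h.2
    (h.1.of_le (by norm_cast : (1 : WithTop ℕ∞) ≤ _)) (by simp)
  refine ⟨K, fun x => ?_⟩
  -- The comparison point is the orthogonal projection of `x` onto the interface, at distance
  -- `|x₁|`.
  have := hK.dist_le_mul x (EuclideanSpace.single 1 (x 1))
  rw [h0 (EuclideanSpace.single 1 (x 1)) (by simp), dist_zero_right, dist_eq_norm] at this
  have e : x - EuclideanSpace.single 1 (x 1) = EuclideanSpace.single 0 (x 0) := by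
    ext i
    fin_cases i <;> simp
  rw [e] at this
  simpa using this

theorem IsTest.cutoff_mul {φ : Plane → ℂ} (h : IsTest φ) (n : ℕ) :
    IsTest fun x => cutoff n x * φ x :=
  mul_left (contDiff_cutoff n) h

theorem tendsto_pd_cutoff_mul (i : Fin 2) (φ : Plane → ℂ) (x : Plane) :
    ∀ᶠ n : ℕ in atTop, pd i (fun x => cutoff n x * φ x) x = step 1 0 x * pd i φ x := by
  by_cases hx : 0 < x 0
  · have ht : Tendsto (fun n : ℕ => (n : ℝ) * x 0) atTop atTop :=
      tendsto_natCast_atTop_atTop.atTop_mul_const hx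
    filter_upwards [ht.eventually_gt_atTop 2] with n hn
    have : (fun x => cutoff n x * φ x) =ᶠ[𝓝 x] φ := by
      have ho : IsOpen {y : Plane | 2 < (n : ℝ) * y 0} := isOpen_lt (by fun_prop) (by fun_prop)
      filter_upwards [ho.mem_nhds hn] with y hy
      rw [cutoff_eq_one (le_of_lt hy), one_mul]
    rw [pd_congr_of_eventuallyEq i this]
    simp [step, hx]
  · refine Eventually.of_forall fun n => ?_
    have : (fun x => cutoff n x * φ x) =ᶠ[𝓝 x] fun _ => 0 := by
      have ho : IsOpen {y : Plane | (n : ℝ) * y 0 < 1} := isOpen_lt (by fun_prop) (by fun_prop)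
      filter_upwards [ho.mem_nhds (show (n : ℝ) * x 0 < 1 by
        have := mul_nonpos_of_nonneg_of_nonpos (Nat.cast_nonneg (α := ℝ) n) (not_lt.1 hx)
        linarith)] with y hy
      rw [cutoff_eq_zero hy.le, zero_mul]
    rw [pd_congr_of_eventuallyEq i this]
    simp [step, hx, pd]

/-- Dominated convergence. This lets an equation valid on the whole plane be localized to the right
half-plane, provided that the test function vanishes on the interface. -/
theorem tendsto_pairing_pd_cutoff_mul {φ : Plane → ℂ} (h : IsTest φ)
    (h0 : ∀ x : Plane, x 0 = 0 → φ x = 0) (u : L2) (j : Fin 3) (i : Fin 2) :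
    Tendsto (fun n : ℕ => pairing u j (pd i fun x => cutoff n x * φ x)) atTop
      (𝓝 (pairing (mulStep 1 0 u) j (pd i φ))) := by
  obtain ⟨K, hK⟩ := norm_le_abs_of_eq_zero h h0
  obtain ⟨C, hC⟩ := norm_pd_cutoff_mul_le hK
  obtain ⟨M, hM⟩ := (h.pd i).2.exists_bound_of_continuous (h.pd i).continuous
  rw [pairing_mulStep]
  have hint : Integrable (fun x => ‖u x j‖ * (tsupport φ).indicator (fun _ => M + C) x) volume := by
    refine (memLp_comp u j).norm.integrable_mul (q := 2) ?_
    exact memLp_indicator_const 2 (isClosed_tsupport φ).measurableSet _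
      (Or.inr h.2.isCompact.measure_lt_top.ne)
  refine tendsto_integral_of_dominated_convergence _ (fun n => ?_) hint (fun n => ?_) ?_
  · exact (integrable_pairing u j ((h.cutoff_mul n).pd i)).1
  · refine Eventually.of_forall fun x => ?_
    rw [norm_mul]
    refine mul_le_mul_of_nonneg_left ?_ (norm_nonneg _)
    by_cases hx : x ∈ tsupport φ
    · rw [Set.indicator_of_mem hx,
        pd_mul i ((contDiff_cutoff n).differentiable (by simp)) h]
      refine (norm_add_le _ _).trans (add_le_add ?_ (hC i n x))
      rw [norm_mul]
      exact (mul_le_of_le_one_left (norm_nonneg _) (norm_cutoff_le n x)).trans (hM x)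
    · rw [Set.indicator_of_notMem hx, pd_eq_zero_of_notMem_tsupport, norm_zero]
      exact fun hx' => hx (tsupport_mul_subset_right hx')
  · refine Eventually.of_forall fun x => ?_
    refine tendsto_const_nhds.congr' ?_
    filter_upwards [tendsto_pd_cutoff_mul i φ x] with n hn
    rw [hn]
    ring

theorem halfPlane_divFree {u : L2} (hu : IsDivFree u) {φ : Plane → ℂ} (h : IsTest φ)
    (h0 : ∀ x : Plane, x 0 = 0 → φ x = 0) :
    pairing (mulStep 1 0 u) 0 (pd 0 φ) + pairing (mulStep 1 0 u) 1 (pd 1 φ) = 0 := by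
  have := (tendsto_pairing_pd_cutoff_mul h h0 u 0 0).add (tendsto_pairing_pd_cutoff_mul h h0 u 1 1)
  exact tendsto_nhds_unique this (tendsto_const_nhds.congr fun n => (hu _ (h.cutoff_mul n)).symm)

theorem halfPlane_curlFree {u : L2} (hu : HasWeakCurl u 0) {φ : Plane → ℂ} (h : IsTest φ)
    (h0 : ∀ x : Plane, x 0 = 0 → φ x = 0) :
    pairing (mulStep 1 0 u) 1 (pd 0 φ) = pairing (mulStep 1 0 u) 0 (pd 1 φ) := by
  refine tendsto_nhds_unique (tendsto_pairing_pd_cutoff_mul h h0 u 1 0)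
    ((tendsto_pairing_pd_cutoff_mul h h0 u 0 1).congr fun n => ?_)
  have := (hu _ (h.cutoff_mul n)).2.2
  rw [pairing_zero] at this
  linear_combination -this

/-! ### Reflection across the interface -/

/-- The reflection `(x₁, x₂) ↦ (-x₁, x₂)`. -/
def reflect : Plane ≃ₗᵢ[ℝ] Plane :=
  LinearIsometryEquiv.piLpCongrRight 2 fun i : Fin 2 =>
    if i = 0 then LinearIsometryEquiv.neg ℝ else LinearIsometryEquiv.refl ℝ ℝ

theorem reflect_zero (x : Plane) : reflect x 0 = -x 0 := by
  simp [reflect]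

theorem reflect_one (x : Plane) : reflect x 1 = x 1 := by
  simp [reflect]

theorem reflect_reflect (x : Plane) : reflect (reflect x) = x := by
  ext i
  fin_cases i <;> simp [reflect_zero, reflect_one]

theorem reflect_single_zero :
    reflect (EuclideanSpace.single 0 1) = -EuclideanSpace.single (0 : Fin 2) (1 : ℝ) := by
  ext i
  fin_cases i <;> simp [reflect_zero, reflect_one]

theorem reflect_single_one :
    reflect (EuclideanSpace.single 1 1) = EuclideanSpace.single (1 : Fin 2) (1 : ℝ) := by
  ext i
  fin_cases i <;> simp [reflect_zero, reflect_one]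

theorem reflect_eq_self {x : Plane} (hx : x 0 = 0) : reflect x = x := by
  ext i
  fin_cases i <;> simp [reflect_zero, reflect_one, hx]

theorem measurePreserving_reflect :
    MeasurePreserving reflect (volume : Measure Plane) volume :=
  reflect.measurePreserving

theorem integral_reflect (f : Plane → ℂ) : ∫ x, f (reflect x) = ∫ x, f x :=
  measurePreserving_reflect.integral_comp reflect.toHomeomorph.measurableEmbedding f

theorem IsTest.reflect {φ : Plane → ℂ} (h : IsTest φ) : IsTest fun x => φ (reflect x) :=
  h.comp_equiv Maxwell2D.reflect.toContinuousLinearEquiv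

theorem pd_zero_reflect {φ : Plane → ℂ} (h : IsTest φ) :
    pd 0 (fun x => φ (reflect x)) = fun x => -pd 0 φ (reflect x) := by
  funext x
  refine (pd_comp_equiv 0 h reflect.toContinuousLinearEquiv x).trans ?_
  change fderiv ℝ φ (reflect x) (reflect _) = _
  rw [reflect_single_zero, map_neg]
  rfl

theorem pd_one_reflect {φ : Plane → ℂ} (h : IsTest φ) :
    pd 1 (fun x => φ (reflect x)) = fun x => pd 1 φ (reflect x) := by
  funext x
  refine (pd_comp_equiv 1 h reflect.toContinuousLinearEquiv x).trans ?_
  change fderiv ℝ φ (reflect x) (reflect _) = _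
  rw [reflect_single_one]
  rfl

theorem pairing_compReflect (u : L2) (j : Fin 3) (φ : Plane → ℂ) :
    pairing (Lp.compMeasurePreserving reflect measurePreserving_reflect u) j φ =
      pairing u j fun x => φ (reflect x) := by
  unfold pairing
  rw [← integral_reflect fun x => u x j * φ (reflect x)]
  refine integral_congr_ae ?_
  filter_upwards [Lp.coeFn_compMeasurePreserving u measurePreserving_reflect] with x hx
  rw [hx, reflect_reflect]
  rfl

theorem ae_eq_zero_of_pairing {u : L2} {j : Fin 3} (h : ∀ φ, IsTest φ → pairing u j φ = 0) :
    ∀ᵐ x ∂(volume : Measure Plane), u x j = 0 := by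
  refine ae_eq_zero_of_integral_contDiff_smul_eq_zero
    ((memLp_comp u j).locallyIntegrable (by norm_num)) fun g hg hc => ?_
  rw [← h (fun x => (g x : ℂ)) ⟨Complex.ofRealCLM.contDiff.comp hg,
    hc.comp_left (g := fun r : ℝ => (r : ℂ)) (by simp)⟩]
  unfold pairing
  refine integral_congr_ae (Eventually.of_forall fun x => ?_)
  simp [mul_comm]

theorem ae_apply_zero_ne_zero : ∀ᵐ x ∂(volume : Measure Plane), x 0 ≠ 0 := by
  let p : Submodule ℝ Plane := LinearMap.ker (EuclideanSpace.proj (𝕜 := ℝ) (0 : Fin 2)).toLinearMap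
  have hp : p ≠ ⊤ := by
    intro h
    have : EuclideanSpace.single (0 : Fin 2) (1 : ℝ) ∈ p := h ▸ Submodule.mem_top
    simp [p] at this
  have h0 := Measure.addHaar_submodule (volume : Measure Plane) p hp
  rw [ae_iff]
  convert h0 using 2
  ext x
  simp [p]

/-! ### Triviality of the kernel -/

section

variable {a b : ℂ} (u : L2) (j : Fin 3) {φ : Plane → ℂ}

theorem mulStep_mulStep (a b a' b' : ℂ) :
    mulStep a b (mulStep a' b' u) = mulStep (a * a') (b * b') u := by
  refine Lp.ext ?_
  filter_upwards [coeFn_mulStep a b (mulStep a' b' u), coeFn_mulStep a' b' u,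
    coeFn_mulStep (a * a') (b * b') u] with x h1 h2 h3
  rw [h1, h2, h3, smul_smul]
  congr 1
  unfold step
  split_ifs <;> rfl

theorem mulStep_eq_add (a b : ℂ) :
    mulStep a b u = a • mulStep 1 0 u + b • (u - mulStep 1 0 u) := by
  refine Lp.ext ?_
  filter_upwards [coeFn_mulStep a b u, Lp.coeFn_add (a • mulStep 1 0 u) (b • (u - mulStep 1 0 u)),
    Lp.coeFn_smul a (mulStep 1 0 u), Lp.coeFn_smul b (u - mulStep 1 0 u),
    Lp.coeFn_sub u (mulStep 1 0 u), coeFn_mulStep 1 0 u] with x h1 h2 h3 h4 h5 h6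
  rw [h1, h2, Pi.add_apply, h3, h4, Pi.smul_apply, Pi.smul_apply, h5, Pi.sub_apply, h6]
  unfold step
  split_ifs <;> simp

theorem mulStep_one_zero_mulStep (a b : ℂ) :
    mulStep 1 0 (mulStep a b u) = a • mulStep 1 0 u := by
  rw [mulStep_mulStep, ← mulStep_mul]
  simp

theorem pairing_mulStep_eq (h : IsTest φ) :
    pairing (mulStep a b u) j φ = a * pairing (mulStep 1 0 u) j φ +
      b * (pairing u j φ - pairing (mulStep 1 0 u) j φ) := by
  rw [mulStep_eq_add, pairing_add _ _ _ h, pairing_smul, pairing_smul, pairing_sub _ _ _ h]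

end

/-- Against test functions vanishing on the interface the equation splits into one per half-plane,
and in each the nonzero constant weight can be divided out. -/
theorem divFree_of_weighted {a b : ℂ} (ha : a ≠ 0) (hb : b ≠ 0) {u : L2}
    (hu : IsDivFree (mulStep a b u)) {φ : Plane → ℂ} (h : IsTest φ)
    (h0 : ∀ x : Plane, x 0 = 0 → φ x = 0) :
    pairing u 0 (pd 0 φ) + pairing u 1 (pd 1 φ) = 0 := by
  have h1 := halfPlane_divFree hu h h0
  rw [mulStep_one_zero_mulStep, pairing_smul, pairing_smul, ← mul_add, mul_eq_zero] at h1
  have h1 := h1.resolve_left ha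
  have h2 := hu _ h
  rw [pairing_mulStep_eq _ _ (h.pd 0), pairing_mulStep_eq _ _ (h.pd 1)] at h2
  have h3 : b * (pairing u 0 (pd 0 φ) + pairing u 1 (pd 1 φ)) = 0 := by
    linear_combination h2 + (b - a) * h1
  exact (mul_eq_zero.1 h3).resolve_left hb

theorem curlFree_weighted (a b : ℂ) {u : L2} (hu : HasWeakCurl u 0) {φ : Plane → ℂ} (h : IsTest φ)
    (h0 : ∀ x : Plane, x 0 = 0 → φ x = 0) :
    pairing (mulStep a b u) 1 (pd 0 φ) = pairing (mulStep a b u) 0 (pd 1 φ) := by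
  have h1 := halfPlane_curlFree hu h h0
  have h2 := (hu _ h).2.2
  rw [pairing_zero] at h2
  rw [pairing_mulStep_eq _ _ (h.pd 0), pairing_mulStep_eq _ _ (h.pd 1)]
  linear_combination (a - b) * h1 + b * h2

/-- Reflection shows that `u₁` is odd and `u₂` even in `x₁`, while `w u₁` is even and `w u₂` odd.
Both parities together force `(w(x) + w(Rx)) u = 0` for these components, where `R` is the
reflection and `w(x) + w(Rx) = a + b` almost everywhere. -/
theorem eq_zero_of_curlFree_of_weighted_divFree {a b : ℂ} (ha : a ≠ 0) (hb : b ≠ 0)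
    (hab : a + b ≠ 0) {u : L2} (hc : HasWeakCurl u 0) (hd : IsDivFree (mulStep a b u)) : u = 0 := by
  let C : L2 → L2 := Lp.compMeasurePreserving reflect measurePreserving_reflect
  let M := mulStep a b u
  have hc2 : ∀ φ, IsTest φ → pairing u 1 (pd 0 φ) = pairing u 0 (pd 1 φ) := by
    intro φ hφ
    have := (hc φ hφ).2.2
    rw [pairing_zero] at this
    linear_combination this
  have hodd : ∀ φ : Plane → ℂ, ∀ x : Plane, x 0 = 0 → φ x - φ (reflect x) = 0 := by
    intro φ x hx
    rw [reflect_eq_self hx, sub_self]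
  have hC : ∀ (v : L2) j {φ : Plane → ℂ}, IsTest φ → pairing (v + C v) j φ =
      pairing v j φ + pairing v j fun x => φ (reflect x) := by
    intro v j φ hφ
    rw [pairing_add _ _ _ hφ, pairing_compReflect]
  have hC' : ∀ (v : L2) j {φ : Plane → ℂ}, IsTest φ → pairing (v - C v) j φ =
      pairing v j φ - pairing v j fun x => φ (reflect x) := by
    intro v j φ hφ
    rw [pairing_sub _ _ _ hφ, pairing_compReflect]
  -- Testing the divergence of this pair with `ψ` is testing that of `u` with `ψ - ψ ∘ R`, which
  -- vanishes on the interface, so the jump of the weight is not seen. The curl leads to `ψ + ψ ∘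
  -- R`, where `u` is curl-free without restriction.
  have hG : ∀ φ, IsTest φ → pairing (u + C u) 0 φ = 0 ∧ pairing (u - C u) 1 φ = 0 := by
    refine fun φ hφ => pairing_eq_zero_of_divFree_curlFree _ _ _ _ (fun ψ hψ => ?_)
      (fun ψ hψ => ?_) hφ
    · have := divFree_of_weighted ha hb hd (hψ.sub hψ.reflect) (hodd ψ)
      rw [pd_sub _ hψ hψ.reflect, pd_sub _ hψ hψ.reflect,
        pairing_fun_sub _ _ (hψ.pd 0) (hψ.reflect.pd 0),
        pairing_fun_sub _ _ (hψ.pd 1) (hψ.reflect.pd 1), pd_zero_reflect hψ, pd_one_reflect hψ,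
        pairing_fun_neg] at this
      rw [hC _ _ (hψ.pd 0), hC' _ _ (hψ.pd 1)]
      linear_combination this
    · have := hc2 _ (hψ.add hψ.reflect)
      rw [pd_add _ hψ hψ.reflect, pd_add _ hψ hψ.reflect,
        pairing_fun_add _ _ (hψ.pd 0) (hψ.reflect.pd 0),
        pairing_fun_add _ _ (hψ.pd 1) (hψ.reflect.pd 1), pd_zero_reflect hψ, pd_one_reflect hψ,
        pairing_fun_neg] at this
      rw [hC _ _ (hψ.pd 1), hC' _ _ (hψ.pd 0)]
      linear_combination this
  -- The roles are exchanged: for the weighted field the divergence equation holds for all test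
  -- functions, the curl equation only for those vanishing on the interface.
  have hK : ∀ φ, IsTest φ → pairing (M - C M) 0 φ = 0 ∧ pairing (M + C M) 1 φ = 0 := by
    refine fun φ hφ => pairing_eq_zero_of_divFree_curlFree _ _ _ _ (fun ψ hψ => ?_)
      (fun ψ hψ => ?_) hφ
    · have := hd _ (hψ.add hψ.reflect)
      rw [pd_add _ hψ hψ.reflect, pd_add _ hψ hψ.reflect,
        pairing_fun_add _ _ (hψ.pd 0) (hψ.reflect.pd 0),
        pairing_fun_add _ _ (hψ.pd 1) (hψ.reflect.pd 1), pd_zero_reflect hψ, pd_one_reflect hψ,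
        pairing_fun_neg] at this
      rw [hC _ _ (hψ.pd 1), hC' _ _ (hψ.pd 0)]
      linear_combination this
    · have := curlFree_weighted a b hc (hψ.sub hψ.reflect) (hodd ψ)
      rw [pd_sub _ hψ hψ.reflect, pd_sub _ hψ hψ.reflect,
        pairing_fun_sub _ _ (hψ.pd 0) (hψ.reflect.pd 0),
        pairing_fun_sub _ _ (hψ.pd 1) (hψ.reflect.pd 1), pd_zero_reflect hψ, pd_one_reflect hψ,
        pairing_fun_neg] at this
      rw [hC _ _ (hψ.pd 0), hC' _ _ (hψ.pd 1)]
      linear_combination this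
  have hu2 : ∀ φ, IsTest φ → pairing u 2 φ = 0 := by
    refine fun φ hφ => pairing_eq_zero_of_harmonic u 2 (fun ψ hψ => ?_) hφ
    have e : pairing u 2 (lap ψ) = _ :=
      pairing_fun_add u 2 ((hψ.pd 0).pd 0) ((hψ.pd 1).pd 1)
    have h0 := (hc _ (hψ.pd 0)).2.1
    have h1 := (hc _ (hψ.pd 1)).1
    rw [pairing_zero] at h0 h1
    rw [e]
    linear_combination -h0 + h1
  have hax : ∀ᵐ x ∂(volume : Measure Plane), step a b x + step a b (reflect x) = a + b := by
    filter_upwards [ae_apply_zero_ne_zero] with x hx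
    unfold step
    rw [reflect_zero]
    rcases lt_or_gt_of_ne hx with h | h
    · rw [if_neg (not_lt.2 h.le), if_pos (by linarith), add_comm]
    · rw [if_pos h, if_neg (by linarith)]
  refine (Lp.eq_zero_iff_ae_eq_zero).2 ?_
  filter_upwards [ae_eq_zero_of_pairing fun φ hφ => (hG φ hφ).1,
    ae_eq_zero_of_pairing fun φ hφ => (hG φ hφ).2, ae_eq_zero_of_pairing fun φ hφ => (hK φ hφ).1,
    ae_eq_zero_of_pairing fun φ hφ => (hK φ hφ).2, ae_eq_zero_of_pairing hu2, hax,
    Lp.coeFn_add u (C u), Lp.coeFn_sub u (C u), Lp.coeFn_add M (C M), Lp.coeFn_sub M (C M),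
    Lp.coeFn_compMeasurePreserving u measurePreserving_reflect,
    Lp.coeFn_compMeasurePreserving M measurePreserving_reflect, coeFn_mulStep a b u,
    measurePreserving_reflect.quasiMeasurePreserving.ae (coeFn_mulStep a b u)]
    with x h0 h1 k0 k1 h2 hs e1 e2 e3 e4 e5 e6 e7 e8
  have e5' : C u x = u (reflect x) := e5
  have e6' : C M x = step a b (reflect x) • u (reflect x) := e6.trans e8
  have e7' : M x = step a b x • u x := e7
  rw [e1, Pi.add_apply, e5'] at h0
  rw [e2, Pi.sub_apply, e5'] at h1
  rw [e4, Pi.sub_apply, e6', e7'] at k0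
  rw [e3, Pi.add_apply, e6', e7'] at k1
  simp only [PiLp.add_apply, PiLp.sub_apply, PiLp.smul_apply, smul_eq_mul] at h0 h1 k0 k1
  -- From `w(x) u₁(x) = w(Rx) u₁(Rx)` and `u₁(Rx) = -u₁(x)`.
  have z0 : (a + b) * u x 0 = 0 := by
    rw [← hs]
    linear_combination k0 + step a b (reflect x) * h0
  have z1 : (a + b) * u x 1 = 0 := by
    rw [← hs]
    linear_combination k1 + step a b (reflect x) * h1
  ext i
  fin_cases i
  · exact (mul_eq_zero.1 z0).resolve_left hab
  · exact (mul_eq_zero.1 z1).resolve_left hab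
  · exact h2

/-- The curl of `E` is divergence-free and curl-free, hence zero; then `E` itself is curl-free and
the reflection argument applies. -/
theorem ker_maxwellOp_zero {a b : ℂ} (ha : a ≠ 0) (hb : b ≠ 0) (hab : a + b ≠ 0) (E : domain a b)
    (hE : maxwellOp 0 a b E = 0) : E = 0 := by
  obtain ⟨F, G, h1, h2⟩ := exists_curlCurl E
  have hF : F = 0 := by
    have := coe_maxwellOp 0 a b E h1 h2
    rw [hE, mulStep_mul, zero_smul, sub_zero] at this
    exact this.symm
  subst hF
  have hG := hasWeakCurl_zero_right h1.isDivFree h2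
  subst hG
  exact Subtype.ext (eq_zero_of_curlFree_of_weighted_divFree ha hb hab h1 E.2.2)

/-! ### Surface fields for opposite coefficients -/

/-- The identification `(x₁, x₂) ↦ x₁ + i x₂` of the plane with `ℂ`. -/
def toComplex : Plane →L[ℝ] ℂ :=
  (EuclideanSpace.proj (0 : Fin 2) : Plane →L[ℝ] ℝ).smulRight (1 : ℂ) +
    (EuclideanSpace.proj (1 : Fin 2) : Plane →L[ℝ] ℝ).smulRight Complex.I

theorem toComplex_re (x : Plane) : (toComplex x).re = x 0 := by
  simp [toComplex]

theorem toComplex_im (x : Plane) : (toComplex x).im = x 1 := by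
  simp [toComplex]

/-- The function `p(1/(z+1)) / (z+1)²`, holomorphic in the right half-plane. -/
def decaying (p : Polynomial ℂ) (z : ℂ) : ℂ := p.eval (z + 1)⁻¹ * ((z + 1)⁻¹) ^ 2

theorem add_one_ne_zero_of_re_pos {z : ℂ} (hz : 0 < z.re) : z + 1 ≠ 0 := by
  intro h
  have := congrArg Complex.re h
  simp at this
  linarith

theorem contDiffAt_decaying (p : Polynomial ℂ) {z : ℂ} (hz : 0 < z.re) (n : WithTop ℕ∞) :
    ContDiffAt ℂ n (decaying p) z := by
  have h1 : ContDiffAt ℂ n (fun z : ℂ => (z + 1)⁻¹) z :=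
    (contDiffAt_id.add contDiffAt_const).inv (add_one_ne_zero_of_re_pos hz)
  have h2 : ContDiff ℂ n fun w => p.eval w := by simpa using p.contDiff_aeval (𝕜 := ℂ) n
  exact (h2.contDiffAt.comp z h1).mul (h1.pow 2)

/-- On the right half-plane `|z + 1|² ≥ 1 + |z|²`. Hence `1 / (z + 1)` stays in the unit disc, where
`p` is bounded, and the squared factor gives the quadratic decay needed for square integrability. -/
theorem exists_decaying_bound (p : Polynomial ℂ) :
    ∃ C, 0 ≤ C ∧ ∀ x : Plane, 0 < x 0 → ‖decaying p (toComplex x)‖ ≤ C * (1 + ‖x‖ ^ 2)⁻¹ := by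
  obtain ⟨C, hC⟩ := (isCompact_closedBall (0 : ℂ) 1).exists_bound_of_continuousOn
    p.continuous.continuousOn
  refine ⟨C, (norm_nonneg _).trans (hC 0 (by simp)), fun x hx => ?_⟩
  have hsq : 1 + ‖x‖ ^ 2 ≤ ‖toComplex x + 1‖ ^ 2 := by
    rw [← Complex.normSq_eq_norm_sq, Complex.normSq_apply, EuclideanSpace.norm_sq_eq]
    simp only [Fin.sum_univ_two, Complex.add_re, Complex.add_im, toComplex_re, toComplex_im,
      Complex.one_re, Complex.one_im, Real.norm_eq_abs, sq_abs]
    nlinarith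
  have h1 : 1 ≤ ‖toComplex x + 1‖ := by
    have : (1 : ℝ) ≤ ‖toComplex x + 1‖ ^ 2 := by nlinarith [sq_nonneg ‖x‖]
    nlinarith [norm_nonneg (toComplex x + 1)]
  rw [decaying, norm_mul, norm_pow, norm_inv, inv_pow]
  have hp : (0 : ℝ) < 1 + ‖x‖ ^ 2 := by positivity
  refine mul_le_mul (hC _ ?_) ((inv_le_inv₀ (by positivity) hp).2 hsq) (by positivity)
    ((norm_nonneg _).trans (hC 0 (by simp)))
  rw [mem_closedBall_zero_iff, norm_inv]
  exact inv_le_one_of_one_le₀ h1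

/-- The restriction of `decaying p` to the right half-plane. -/
def halfProfile (p : Polynomial ℂ) (x : Plane) : ℂ :=
  if 0 < x 0 then decaying p (toComplex x) else 0

theorem isOpen_halfPlane : IsOpen {x : Plane | 0 < x 0} :=
  isOpen_lt continuous_const (by fun_prop)

theorem continuousOn_decaying (p : Polynomial ℂ) :
    ContinuousOn (fun x : Plane => decaying p (toComplex x)) {x | 0 < x 0} := by
  intro x hx
  have := (contDiffAt_decaying p (z := toComplex x) (by rwa [toComplex_re]) 0).continuousAt
  exact (this.comp toComplex.continuous.continuousAt).continuousWithinAt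

theorem memLp_inv_one_add_norm_sq :
    MemLp (fun x : Plane => (1 + ‖x‖ ^ 2)⁻¹) 2 (volume : Measure Plane) := by
  have hc : Continuous fun x : Plane => (1 + ‖x‖ ^ 2)⁻¹ :=
    Continuous.inv₀ (by fun_prop) fun x => by positivity
  rw [memLp_two_iff_integrable_sq hc.aestronglyMeasurable]
  have := integrable_rpow_neg_one_add_norm_sq (E := Plane) (μ := volume) (r := 4) (by simp; norm_num)
  refine this.congr (Eventually.of_forall fun x => ?_)
  have h0 : (0 : ℝ) ≤ 1 + ‖x‖ ^ 2 := by positivity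
  beta_reduce
  rw [show (-(4 : ℝ) / 2) = -((2 : ℕ) : ℝ) by norm_num, Real.rpow_neg h0, Real.rpow_natCast, inv_pow]

theorem memLp_single_halfProfile (j : Fin 3) (p : Polynomial ℂ) :
    MemLp (fun x => EuclideanSpace.single j (halfProfile p x)) 2 (volume : Measure Plane) := by
  have hm : AEStronglyMeasurable (halfProfile p) (volume : Measure Plane) := by
    have h := ((continuousOn_decaying p).aestronglyMeasurable (μ := volume)
      isOpen_halfPlane.measurableSet)
    have h2 := (aestronglyMeasurable_indicator_iff isOpen_halfPlane.measurableSet).2 h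
    refine h2.congr (Eventually.of_forall fun x => ?_)
    simp [halfProfile, Set.indicator_apply]
  obtain ⟨C, hC0, hC⟩ := exists_decaying_bound p
  refine memLp_inv_one_add_norm_sq.of_le_mul (c := C) ?_ (Eventually.of_forall fun x => ?_)
  · have hs : Continuous fun w : ℂ => EuclideanSpace.single j w := by
      refine (PiLp.continuous_toLp 2 _).comp (continuous_pi fun k => ?_)
      by_cases hk : k = j
      · subst hk
        simpa using continuous_id'
      · simpa [hk] using continuous_const
    exact hs.comp_aestronglyMeasurable hm
  · have hp : (0 : ℝ) ≤ (1 + ‖x‖ ^ 2)⁻¹ := by positivity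
    rw [PiLp.norm_single, Real.norm_eq_abs, abs_of_nonneg hp]
    unfold halfProfile
    split_ifs with hx
    · exact hC x hx
    · rw [norm_zero]
      positivity

/-- The field with `j`-th component `halfProfile p`, the other components being `0`. -/
def halfField (j : Fin 3) : Polynomial ℂ →ₗ[ℂ] L2 where
  toFun p := (memLp_single_halfProfile j p).toLp _
  map_add' p q := by
    rw [← MemLp.toLp_add]
    refine MemLp.toLp_congr _ _ (Eventually.of_forall fun x => ?_)
    ext k
    by_cases hk : k = j
    · simp only [Pi.add_apply, PiLp.add_apply, PiLp.single_apply, hk, if_true, halfProfile]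
      split_ifs <;> simp [decaying, add_mul]
    · simp [hk]
  map_smul' c p := by
    rw [RingHom.id_apply, ← MemLp.toLp_const_smul]
    refine MemLp.toLp_congr _ _ (Eventually.of_forall fun x => ?_)
    ext k
    by_cases hk : k = j
    · simp only [Pi.smul_apply, PiLp.smul_apply, PiLp.single_apply, hk, if_true, halfProfile]
      split_ifs <;> simp [decaying, mul_assoc]
    · simp [hk]

section

variable (j k : Fin 3) (p : Polynomial ℂ) (φ : Plane → ℂ)

theorem coeFn_halfField :
    halfField j p =ᵐ[volume] fun x => EuclideanSpace.single j (halfProfile p x) :=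
  MemLp.coeFn_toLp (memLp_single_halfProfile j p)

theorem pairing_halfField_same :
    pairing (halfField j p) j φ = ∫ x, halfProfile p x * φ x := by
  unfold pairing
  refine integral_congr_ae ?_
  filter_upwards [coeFn_halfField j p] with x hx
  simp [hx]

theorem pairing_halfField_of_ne (hjk : k ≠ j) : pairing (halfField j p) k φ = 0 := by
  unfold pairing
  rw [← integral_zero Plane ℂ]
  refine integral_congr_ae ?_
  filter_upwards [coeFn_halfField j p] with x hx
  simp [hx, hjk]

theorem mulStep_halfField (a b : ℂ) : mulStep a b (halfField j p) = a • halfField j p := by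
  refine Lp.ext ?_
  filter_upwards [coeFn_mulStep a b (halfField j p), Lp.coeFn_smul a (halfField j p),
    coeFn_halfField j p] with x h1 h2 h3
  rw [h1, h2, Pi.smul_apply, h3]
  unfold step halfProfile
  split_ifs
  · rfl
  · ext k
    by_cases hk : k = j <;> simp [hk]

end

/-- The pullback of fields by the reflection across the interface, componentwise. -/
def compReflect : L2 →ₗ[ℂ] L2 := Lp.compMeasurePreservingₗ ℂ reflect measurePreserving_reflect

theorem pairing_compReflect_apply (u : L2) (j : Fin 3) (φ : Plane → ℂ) :
    pairing (compReflect u) j φ = pairing u j fun x => φ (reflect x) :=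
  pairing_compReflect u j φ

theorem mulStep_compReflect (a b : ℂ) (u : L2) :
    mulStep a b (compReflect u) = compReflect (mulStep b a u) := by
  refine Lp.ext ?_
  filter_upwards [coeFn_mulStep a b (compReflect u),
    Lp.coeFn_compMeasurePreserving u measurePreserving_reflect,
    Lp.coeFn_compMeasurePreserving (mulStep b a u) measurePreserving_reflect,
    measurePreserving_reflect.quasiMeasurePreserving.ae (coeFn_mulStep b a u),
    ae_apply_zero_ne_zero] with x h1 h2 h3 h4 hx
  have h2' : compReflect u x = u (reflect x) := h2
  have h3' : compReflect (mulStep b a u) x = step b a (reflect x) • u (reflect x) := h3.trans h4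
  rw [h1, h2', h3']
  congr 1
  unfold step
  rw [reflect_zero]
  rcases lt_or_gt_of_ne hx with h | h
  · rw [if_neg (not_lt.2 h.le), if_pos (by linarith)]
  · rw [if_pos h, if_neg (by linarith)]

theorem integral_pd_eq_zero (i : Fin 2) {φ : Plane → ℂ} (h : IsTest φ) : ∫ x, pd i φ x = 0 := by
  have := integral_mul_fderiv_eq_neg_fderiv_mul_of_integrable (μ := (volume : Measure Plane))
    (v := EuclideanSpace.single i (1 : ℝ)) (f := fun _ => (1 : ℂ)) (g := φ)
    (by simp) (by simp only [one_mul]; exact (h.pd i).integrable)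
    (by simpa only [one_mul] using h.integrable)
    (fun x _ => differentiableAt_const _) (fun x _ => h.differentiable x)
  simpa [pd] using this

/-- With `h` holomorphic, `(∂₁ + i ∂₂)(h φ) = h (∂₁ + i ∂₂) φ`, and the left side is a combination
of derivatives of a test function, so it integrates to zero. -/
theorem integral_halfProfile_dbar (p : Polynomial ℂ) {φ : Plane → ℂ} (h : IsTest φ)
    (hsupp : tsupport φ ⊆ {x | 0 < x 0}) :
    (∫ x, halfProfile p x * pd 0 φ x) + Complex.I * ∫ x, halfProfile p x * pd 1 φ x = 0 := by
  let q : Plane → ℂ := fun x => decaying p (toComplex x) * φ x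
  have hq : IsTest q := by
    refine ⟨contDiff_iff_contDiffAt.2 fun x => ?_, h.2.mul_left⟩
    by_cases hx : x ∈ tsupport φ
    · refine ContDiffAt.mul ?_ h.1.contDiffAt
      have := (contDiffAt_decaying p (z := toComplex x) (by rw [toComplex_re]; exact hsupp hx)
        (⊤ : ℕ∞)).restrict_scalars ℝ
      exact this.comp x toComplex.contDiff.contDiffAt
    · refine (contDiffAt_const (c := (0 : ℂ))).congr_of_eventuallyEq ?_
      filter_upwards [(isClosed_tsupport φ).isOpen_compl.mem_nhds hx] with y hy
      simp [q, image_eq_zero_of_notMem_tsupport hy]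
  let d : Plane → ℂ := fun x => deriv (decaying p) (toComplex x)
  have hpd : ∀ i x, pd i q x = halfProfile p x * pd i φ x +
      d x * toComplex (EuclideanSpace.single i 1) * φ x := by
    intro i x
    by_cases hx : x ∈ tsupport φ
    · have hx0 : 0 < x 0 := hsupp hx
      have h1 : HasDerivAt (decaying p) (d x) (toComplex x) :=
        ((contDiffAt_decaying p (z := toComplex x) (by rwa [toComplex_re])
          1).differentiableAt (by simp)).hasDerivAt
      have h2 := h1.complexToReal_fderiv.comp x toComplex.hasFDerivAt
      have h3 := h2.mul (h.differentiable x).hasFDerivAt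
      have h4 : HasFDerivAt q _ x := h3
      rw [pd, h4.fderiv]
      simp only [halfProfile, if_pos hx0, pd]
      simp
      ring
    · rw [pd_eq_zero_of_notMem_tsupport i hx, image_eq_zero_of_notMem_tsupport hx,
        pd_eq_zero_of_notMem_tsupport i fun hx' => hx (tsupport_mul_subset_right hx')]
      simp
  have hint : ∀ i, Integrable (fun x => halfProfile p x * pd i φ x) (volume : Measure Plane) := by
    intro i
    refine (integrable_pairing (halfField 0 p) 0 (h.pd i)).congr ?_
    filter_upwards [coeFn_halfField 0 p] with x hx
    simp [hx]
  rw [← integral_const_mul, ← integral_add (hint 0) ((hint 1).const_mul _)]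
  have e : ∀ x, halfProfile p x * pd 0 φ x + Complex.I * (halfProfile p x * pd 1 φ x) =
      pd 0 q x + Complex.I * pd 1 q x := by
    intro x
    rw [hpd, hpd]
    have e0 : toComplex (EuclideanSpace.single 0 1) = 1 := by
      apply Complex.ext <;> simp [toComplex]
    have e1 : toComplex (EuclideanSpace.single 1 1) = Complex.I := by
      apply Complex.ext <;> simp [toComplex]
    rw [e0, e1]
    linear_combination -(d x * φ x) * Complex.I_sq
  simp_rw [e]
  rw [integral_add (hq.pd 0).integrable ((hq.pd 1).integrable.const_mul _), integral_const_mul,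
    integral_pd_eq_zero 0 hq, integral_pd_eq_zero 1 hq]
  simp

theorem tsupport_cutoff_mul_subset {n : ℕ} (hn : 0 < n) (φ : Plane → ℂ) :
    tsupport (fun x => cutoff n x * φ x) ⊆ {x | 0 < x 0} := by
  have hsub : tsupport (fun x => cutoff n x * φ x) ⊆ {x : Plane | 1 ≤ n * x 0} := by
    refine closure_minimal (fun x hx => ?_) (isClosed_le continuous_const (by fun_prop))
    by_contra hlt
    exact hx (by simp [cutoff_eq_zero (not_le.1 hlt).le])
  intro x hx
  have h1 : (1 : ℝ) ≤ n * x 0 := hsub hx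
  have hn' : (0 : ℝ) < n := by exact_mod_cast hn
  exact pos_of_mul_pos_right (by linarith : (0 : ℝ) < n * x 0) hn'.le

/-- The cutoff argument extends the identity to test functions that reach the interface but vanish
on it, such as `φ - φ ∘ R`. -/
theorem integral_halfProfile_dbar_of_eq_zero (p : Polynomial ℂ) {φ : Plane → ℂ} (h : IsTest φ)
    (h0 : ∀ x : Plane, x 0 = 0 → φ x = 0) :
    (∫ x, halfProfile p x * pd 0 φ x) + Complex.I * ∫ x, halfProfile p x * pd 1 φ x = 0 := by
  have hl := (tendsto_pairing_pd_cutoff_mul h h0 (halfField 0 p) 0 0).add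
    ((tendsto_pairing_pd_cutoff_mul h h0 (halfField 0 p) 0 1).const_mul Complex.I)
  simp only [mulStep_halfField, one_smul, pairing_halfField_same] at hl
  refine tendsto_nhds_unique hl (tendsto_const_nhds.congr' ?_)
  filter_upwards [eventually_gt_atTop 0] with n hn
  exact (integral_halfProfile_dbar p (h.cutoff_mul n) (tsupport_cutoff_mul_subset hn φ)).symm

/-- The field equal to `(h, i h, 0)` on `{x₁ > 0}`, where `h = decaying p`, and extended by
reflection to `{x₁ < 0}`. -/
def surfaceField : Polynomial ℂ →ₗ[ℂ] L2 :=
  halfField 0 - compReflect ∘ₗ halfField 0 +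
    Complex.I • (halfField 1 + compReflect ∘ₗ halfField 1)

theorem surfaceField_apply (p : Polynomial ℂ) : surfaceField p =
    halfField 0 p - compReflect (halfField 0 p) +
      Complex.I • (halfField 1 p + compReflect (halfField 1 p)) := rfl

/-- The opposite weight on the left flips the sign of every reflected term, exchanging even and odd.
-/
theorem mulStep_surfaceField (a : ℂ) (p : Polynomial ℂ) : mulStep a (-a) (surfaceField p) =
    a • (halfField 0 p + compReflect (halfField 0 p) +
      Complex.I • (halfField 1 p - compReflect (halfField 1 p))) := by
  simp only [surfaceField_apply, map_add, map_sub, map_smul, mulStep_compReflect,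
    mulStep_halfField]
  module

/-- Moving the reflections onto the test function leaves, up to the factor `-i`, the identity for `φ
- φ ∘ R`. The weighted divergence in `isDivFree_mulStep_surfaceField` reduces to the same identity.
-/
theorem hasWeakCurl_surfaceField (p : Polynomial ℂ) : HasWeakCurl (surfaceField p) 0 := by
  intro φ h
  have hp : ∀ j {ψ : Plane → ℂ}, IsTest ψ → pairing (surfaceField p) j ψ =
      pairing (halfField 0 p) j ψ - pairing (halfField 0 p) j (fun x => ψ (reflect x)) +
      Complex.I * (pairing (halfField 1 p) j ψ +
        pairing (halfField 1 p) j (fun x => ψ (reflect x))) := by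
    intro j ψ hψ
    rw [surfaceField_apply, pairing_add _ _ _ hψ, pairing_sub _ _ _ hψ, pairing_smul,
      pairing_add _ _ _ hψ, pairing_compReflect_apply, pairing_compReflect_apply]
  rw [hp _ (h.pd 0), hp _ (h.pd 1), hp _ (h.pd 0), hp _ (h.pd 1)]
  simp only [pairing_halfField_same, pairing_halfField_of_ne 0 1 _ _ (by decide),
    pairing_halfField_of_ne 1 0 _ _ (by decide), pairing_halfField_of_ne 0 2 _ _ (by decide),
    pairing_halfField_of_ne 1 2 _ _ (by decide), pairing_zero]
  refine ⟨by simp, by simp, ?_⟩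
  have hζ := integral_halfProfile_dbar_of_eq_zero p (h.sub h.reflect) fun x hx => by
    rw [reflect_eq_self hx, sub_self]
  rw [pd_sub _ h h.reflect, pd_sub _ h h.reflect, pd_zero_reflect h, pd_one_reflect h] at hζ
  simp only [← pairing_halfField_same 0] at hζ ⊢
  rw [pairing_fun_sub _ _ (h.pd 0) (h.pd 0).reflect.neg, pairing_fun_sub _ _ (h.pd 1)
    (h.pd 1).reflect, pairing_fun_neg] at hζ
  simp only [pairing_halfField_same] at hζ ⊢
  linear_combination Complex.I * hζ + (-(∫ x, halfProfile p x * pd 1 φ x) +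
    ∫ x, halfProfile p x * pd 1 φ (reflect x)) * Complex.I_sq

theorem isDivFree_mulStep_surfaceField (a : ℂ) (p : Polynomial ℂ) :
    IsDivFree (mulStep a (-a) (surfaceField p)) := by
  intro φ h
  have hp : ∀ j {ψ : Plane → ℂ}, IsTest ψ → pairing (mulStep a (-a) (surfaceField p)) j ψ =
      a * (pairing (halfField 0 p) j ψ + pairing (halfField 0 p) j (fun x => ψ (reflect x)) +
      Complex.I * (pairing (halfField 1 p) j ψ -
        pairing (halfField 1 p) j (fun x => ψ (reflect x)))) := by
    intro j ψ hψ
    rw [mulStep_surfaceField, pairing_smul, pairing_add _ _ _ hψ, pairing_add _ _ _ hψ,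
      pairing_smul, pairing_sub _ _ _ hψ, pairing_compReflect_apply, pairing_compReflect_apply]
  rw [hp _ (h.pd 0), hp _ (h.pd 1)]
  have hζ := integral_halfProfile_dbar_of_eq_zero p (h.sub h.reflect) fun x hx => by
    rw [reflect_eq_self hx, sub_self]
  rw [pd_sub _ h h.reflect, pd_sub _ h h.reflect, pd_zero_reflect h, pd_one_reflect h] at hζ
  simp only [← pairing_halfField_same 0] at hζ
  rw [pairing_fun_sub _ _ (h.pd 0) (h.pd 0).reflect.neg, pairing_fun_sub _ _ (h.pd 1)
    (h.pd 1).reflect, pairing_fun_neg] at hζ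
  simp only [pairing_halfField_same, pairing_halfField_of_ne 0 1 _ _ (by decide),
    pairing_halfField_of_ne 1 0 _ _ (by decide)] at hζ ⊢
  linear_combination a * hζ

theorem eq_zero_of_halfProfile_ae_eq_zero {p : Polynomial ℂ}
    (h : ∀ᵐ x ∂(volume : Measure Plane), halfProfile p x = 0) : p = 0 := by
  have heq : Set.EqOn (fun x : Plane => decaying p (toComplex x)) 0 {x | 0 < x 0} := by
    refine Measure.eqOn_open_of_ae_eq (μ := volume) ?_ isOpen_halfPlane (continuousOn_decaying p)
      continuousOn_const
    refine (ae_restrict_iff' isOpen_halfPlane.measurableSet).2 ?_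
    filter_upwards [h] with x hx hx0
    simpa [halfProfile, show 0 < x 0 from hx0] using hx
  refine Polynomial.eq_zero_of_infinite_isRoot p ?_
  -- At the points `z = n + 1` the argument of `p` is `1 / (n + 2)`, which yields infinitely many
  -- roots.
  have hinj : Function.Injective fun n : ℕ => ((n : ℂ) + 1 + 1)⁻¹ := by
    intro m n hmn
    simpa using hmn
  refine (Set.infinite_range_of_injective hinj).mono ?_
  rintro _ ⟨n, rfl⟩
  have hn := heq (x := EuclideanSpace.single 0 ((n : ℝ) + 1)) (by
    simp only [Set.mem_ofPred_eq, PiLp.single_apply, if_true]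
    positivity)
  have ez : toComplex (EuclideanSpace.single 0 ((n : ℝ) + 1)) = (n : ℂ) + 1 := by
    apply Complex.ext <;> simp [toComplex]
  simp only [ez, decaying, Pi.zero_apply] at hn
  have hne : ((n : ℂ) + 1 + 1) ≠ 0 := by
    exact_mod_cast (by positivity : ((n : ℝ) + 1 + 1) ≠ 0)
  exact (mul_eq_zero.1 hn).resolve_right (pow_ne_zero _ (inv_ne_zero hne))

theorem ker_surfaceField : LinearMap.ker surfaceField = ⊥ := by
  refine LinearMap.ker_eq_bot'.2 fun p hp => ?_
  -- Restricting to the right half-plane removes the reflected terms.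
  have h1 : halfField 0 p + Complex.I • halfField 1 p = 0 := by
    have := congrArg (mulStep 1 0) hp
    simpa [surfaceField_apply, mulStep_compReflect, mulStep_halfField] using this
  have h2 : ∀ φ, IsTest φ → pairing (halfField 0 p) 0 φ = 0 := by
    intro φ hφ
    have := congrArg (fun u => pairing u 0 φ) h1
    simp only [pairing_add _ _ _ hφ, pairing_smul, pairing_halfField_of_ne 1 0 _ _ (by decide),
      pairing_zero, mul_zero, add_zero] at this
    exact this
  refine eq_zero_of_halfProfile_ae_eq_zero ?_
  filter_upwards [ae_eq_zero_of_pairing h2, coeFn_halfField 0 p] with x hx hx'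
  rw [hx'] at hx
  simpa using hx

theorem surfaceField_mem_domain (a : ℂ) (p : Polynomial ℂ) : surfaceField p ∈ domain a (-a) :=
  ⟨⟨0, 0, hasWeakCurl_surfaceField p, HasWeakCurl.zero⟩, isDivFree_mulStep_surfaceField a p⟩

theorem maxwellOp_surfaceField (a : ℂ) (p : Polynomial ℂ) :
    maxwellOp 0 a (-a) ⟨surfaceField p, surfaceField_mem_domain a p⟩ = 0 := by
  refine Subtype.ext ((coe_maxwellOp_mk 0 a (-a) _ (hasWeakCurl_surfaceField p)
    HasWeakCurl.zero).trans ?_)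
  rw [mulStep_mul, zero_smul, sub_zero]
  rfl

theorem not_hasFiniteKernel_of_add_eq_zero {a b : ℂ} (hab : a + b = 0) :
    ¬ HasFiniteKernel (maxwellOp 0 a b) := by
  obtain rfl : b = -a := by linear_combination hab
  let Φ : Polynomial ℂ →ₗ[ℂ] domain a (-a) :=
    surfaceField.codRestrict _ (surfaceField_mem_domain a)
  have hΦ : LinearMap.ker Φ = ⊥ := by
    rw [LinearMap.ker_codRestrict, ker_surfaceField]
  exact not_finiteDimensional_of_linearIndependent
    ((Polynomial.basisMonomials ℂ).linearIndependent.map' Φ hΦ)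
    fun n => maxwellOp_surfaceField a (Polynomial.basisMonomials ℂ n)

/-! ### Fredholm properties on the exceptional set -/

section

variable {c a b : ℂ}

/-- In a half-plane where the coefficient `c w` vanishes, there are weakly null normalized test
fields which the operator, acting symmetrically on them, sends to `0` in norm. -/
theorem exists_singular_sequence (hcab : c * a = 0 ∨ c * b = 0) :
    ∃ (e : ℕ → domain a b) (f : ℕ → rangeSpace) (φ : ℕ → Plane → ℂ) (h : ∀ n, IsTest (φ n)),
      (∀ n, (f n : L2) = testField 2 _ (h n)) ∧
      Orthonormal ℂ (fun n => (e n : L2)) ∧ Orthonormal ℂ f ∧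
      Tendsto (fun n => ‖maxwellOp c a b (e n)‖) atTop (𝓝 0) ∧
      ∀ n (E : domain a b), inner ℂ (f n) (maxwellOp c a b E) =
        inner ℂ (maxwellOp c a b (e n) : L2) (E : L2) := by
  obtain ⟨s, hs, hs'⟩ : ∃ s : ℝ, |s| = 1 ∧ ((s = 1 ∧ c * a = 0) ∨ (s = -1 ∧ c * b = 0)) := by
    rcases hcab with h | h
    · exact ⟨1, by simp, Or.inl ⟨rfl, h⟩⟩
    · exact ⟨-1, by simp, Or.inr ⟨rfl, h⟩⟩
  obtain ⟨φ, h, hN, hsupp, hdisj, hlap⟩ := exists_test_sequence s hs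
  have hφ : ∀ n x, step (c * a) (c * b) x * φ n x = 0 := fun n x =>
    step_mul_eq_zero s hs' fun hx => image_eq_zero_of_notMem_tsupport fun hx' => hx (hsupp n hx')
  have ho : Orthonormal ℂ fun n => testField 2 _ (h n) := by
    refine ⟨hN, fun m n hmn => inner_testField_of_disjoint _ _ _ _ fun x => ?_⟩
    by_cases hx : x ∈ tsupport (φ m)
    · rw [image_eq_zero_of_notMem_tsupport (Set.disjoint_left.1 (hdisj m n hmn) hx), mul_zero]
    · rw [image_eq_zero_of_notMem_tsupport hx, zero_mul]
  refine ⟨fun n => ⟨_, testField_two_mem_domain a b (h n)⟩,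
    fun n => ⟨_, testField_two_mem_rangeSpace (h n)⟩, φ, h, fun n => rfl, ho,
    ⟨fun n => hN n, fun m n hmn => ho.2 hmn⟩, ?_, fun n E => ?_⟩
  · refine hlap.congr fun n => ?_
    rw [← coe_maxwellOp_testField c a b (h n) (hφ n)]
    rfl
  · rw [coe_maxwellOp_testField c a b (h n) (hφ n)]
    exact inner_testField_maxwellOp c a b (h n) (hφ n) E

/-- Orthogonality to the images of third-component test fields says that the third component of `v`
is harmonic, so Liouville applies. -/
theorem inner_testField_eq_zero_of_orthogonal_range {v : L2}
    (hv : ∀ u : domain a b, inner ℂ (maxwellOp 0 a b u : L2) v = 0) {φ : Plane → ℂ}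
    (h : IsTest φ) : inner ℂ (testField 2 φ h) v = 0 := by
  rw [inner_testField]
  refine pairing_eq_zero_of_harmonic _ 2 (fun ψ hψ => ?_) h.conjugate
  have h0 := hv ⟨_, testField_two_mem_domain a b hψ.conjugate⟩
  rw [coe_maxwellOp_testField 0 a b hψ.conjugate fun x => by simp [step], inner_testField,
    lap_conj hψ] at h0
  simp only [map_neg, Complex.conj_conj] at h0
  rw [pairing_fun_neg] at h0
  exact neg_eq_zero.1 h0

/-- If `a` or `b` is zero, the infinite-dimensional kernel leaves only a finite-dimensional cokernel
to exclude. Otherwise `c = 0`, and closed range alone is contradictory, whatever the kernel and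
cokernel. -/
theorem not_isSemiFredholm_maxwellOp (hcab : c * a = 0 ∨ c * b = 0) :
    ¬ IsSemiFredholm (maxwellOp c a b) := by
  rintro ⟨hcl, hfin⟩
  obtain ⟨e, f, φ, h, hf, -, hfo, hT, hsymm⟩ := exists_singular_sequence hcab
  have hT' : Tendsto (fun n => ‖(maxwellOp c a b (e n) : L2)‖) atTop (𝓝 0) := hT
  by_cases hab : a = 0 ∨ b = 0
  · exact not_hasClosedRange_of_finite_cokernel hsymm hfo hT'
      (hfin.resolve_left (not_hasFiniteKernel_of_eq_zero c hab)) hcl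
  · obtain ⟨ha, hb⟩ := not_or.1 hab
    obtain rfl : c = 0 := by
      rcases hcab with h | h
      · exact (mul_eq_zero.1 h).resolve_right ha
      · exact (mul_eq_zero.1 h).resolve_right hb
    refine not_hasClosedRange_of_mem_range hsymm hfo.1 hT' (fun n => hcl.mem_range fun v hv => ?_)
      hcl
    rw [Submodule.coe_inner, hf n]
    exact inner_testField_eq_zero_of_orthogonal_range hv (h n)

end

/-! ### Spectra of the pencil on the exceptional set. -/

variable {S : Set ℂ} {Wp Wm : (Sᶜ : Set ℂ) → ℂ}

theorem pencil_op (ω : (Sᶜ : Set ℂ)) :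
    (pencil S Wp Wm).op ω 1 = maxwellOp ((ω : ℂ) ^ 2) (Wp ω) (Wm ω) := rfl

theorem mem_weylSpectrum {ω : (Sᶜ : Set ℂ)} (hω : ω ∈ exceptionalSet S Wp Wm) :
    ω ∈ (pencil S Wp Wm).weylSpectrum := by
  obtain ⟨e, -, -, -, -, heo, -, hT, -⟩ := exists_singular_sequence hω
  refine ⟨e, heo.1, fun v => ?_, hT⟩
  have := (heo.tendsto_inner_zero v).star
  simpa using this

theorem not_hasFiniteKernel_maxwellOp {c a b : ℂ} (hcab : c * a = 0 ∨ c * b = 0)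
    (h : a = 0 ∨ b = 0 ∨ a + b = 0) : ¬ HasFiniteKernel (maxwellOp c a b) := by
  by_cases hab : a = 0 ∨ b = 0
  · exact not_hasFiniteKernel_of_eq_zero c hab
  · obtain ⟨ha, hb⟩ := not_or.1 hab
    obtain rfl : c = 0 := by
      rcases hcab with h | h
      · exact (mul_eq_zero.1 h).resolve_right ha
      · exact (mul_eq_zero.1 h).resolve_right hb
    exact not_hasFiniteKernel_of_add_eq_zero ((h.resolve_left ha).resolve_left hb)

theorem mem_infinitePointSpectrum {ω : (Sᶜ : Set ℂ)} (hω : ω ∈ exceptionalSet S Wp Wm)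
    (h : Wp ω = 0 ∨ Wm ω = 0 ∨ Wp ω + Wm ω = 0) :
    ω ∈ (pencil S Wp Wm).infinitePointSpectrum := by
  have hk : ¬ HasFiniteKernel ((pencil S Wp Wm).op ω 1) := not_hasFiniteKernel_maxwellOp hω h
  refine ⟨?_, Or.inl hk⟩
  by_contra hne
  refine hk ?_
  have hbot : LinearMap.ker ((pencil S Wp Wm).op ω 1) = ⊥ := by
    refine LinearMap.ker_eq_bot'.2 fun u hu => ?_
    by_contra hu0
    exact hne ⟨u, hu0, hu⟩
  unfold HasFiniteKernel
  rw [hbot]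
  infer_instance

/-- If neither value nor their sum vanishes, membership in the exceptional set forces `ω² = 0`, and
there the kernel is trivial. -/
theorem eq_zero_of_mem_pointSpectrum {ω : (Sᶜ : Set ℂ)} (hω : ω ∈ exceptionalSet S Wp Wm)
    (h : ω ∈ (pencil S Wp Wm).pointSpectrum) : Wp ω = 0 ∨ Wm ω = 0 ∨ Wp ω + Wm ω = 0 := by
  by_contra! hne
  obtain ⟨ha, hb, hab⟩ := hne
  obtain ⟨u, hu0, hu⟩ := h
  rw [pencil_op] at hu
  have hc : (ω : ℂ) ^ 2 = 0 := by
    rcases hω with h | h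
    · exact (mul_eq_zero.1 h).resolve_right ha
    · exact (mul_eq_zero.1 h).resolve_right hb
  rw [hc] at hu
  exact hu0 (ker_maxwellOp_zero ha hb hab u hu)

end Maxwell2D

end

theorem theorem2p4 (S : Set ℂ) (Wp Wm : (Sᶜ : Set ℂ) → ℂ) :
    -- Spectrum
    (Maxwell2D.pencil S Wp Wm).spectrum ∩ Maxwell2D.exceptionalSet S Wp Wm = Maxwell2D.exceptionalSet S Wp Wm ∧
    -- Point spectrum
    (Maxwell2D.pencil S Wp Wm).finitePointSpectrum ∩ Maxwell2D.exceptionalSet S Wp Wm = ∅ ∧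
    (Maxwell2D.pencil S Wp Wm).infinitePointSpectrum ∩ Maxwell2D.exceptionalSet S Wp Wm =
      {ω | ω ∈ Maxwell2D.exceptionalSet S Wp Wm ∧ (Wp ω = 0 ∨ Wm ω = 0 ∨ Wp ω + Wm ω = 0)} ∧
    -- Essential spectra
    (Maxwell2D.pencil S Wp Wm).essSpectrum1 ∩ Maxwell2D.exceptionalSet S Wp Wm = Maxwell2D.exceptionalSet S Wp Wm ∧
    (Maxwell2D.pencil S Wp Wm).essSpectrum2 ∩ Maxwell2D.exceptionalSet S Wp Wm = Maxwell2D.exceptionalSet S Wp Wm ∧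
    (Maxwell2D.pencil S Wp Wm).essSpectrum3 ∩ Maxwell2D.exceptionalSet S Wp Wm = Maxwell2D.exceptionalSet S Wp Wm ∧
    (Maxwell2D.pencil S Wp Wm).essSpectrum4 ∩ Maxwell2D.exceptionalSet S Wp Wm = Maxwell2D.exceptionalSet S Wp Wm ∧
    (Maxwell2D.pencil S Wp Wm).essSpectrum5 ∩ Maxwell2D.exceptionalSet S Wp Wm = Maxwell2D.exceptionalSet S Wp Wm ∧
    -- Weyl spectrum
    (Maxwell2D.pencil S Wp Wm).weylSpectrum ∩ Maxwell2D.exceptionalSet S Wp Wm = Maxwell2D.exceptionalSet S Wp Wm := by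
  have hess : ∀ ω ∈ Maxwell2D.exceptionalSet S Wp Wm, _ := fun ω hω =>
    OperatorPencil.mem_essSpectrum_of_not_isSemiFredholm (P := Maxwell2D.pencil S Wp Wm)
      (ω := ω) (Maxwell2D.not_isSemiFredholm_maxwellOp hω)
  refine ⟨Set.inter_eq_right.2 fun ω hω => (hess ω hω).1, ?_, ?_,
    Set.inter_eq_right.2 fun ω hω => (hess ω hω).2.1,
    Set.inter_eq_right.2 fun ω hω => (hess ω hω).2.2.1,
    Set.inter_eq_right.2 fun ω hω => (hess ω hω).2.2.2.1,
    Set.inter_eq_right.2 fun ω hω => (hess ω hω).2.2.2.2.1,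
    Set.inter_eq_right.2 fun ω hω => (hess ω hω).2.2.2.2.2,
    Set.inter_eq_right.2 fun ω hω => Maxwell2D.mem_weylSpectrum hω⟩
  -- Any eigenvalue in the exceptional set satisfies one of the three equations, and each of them
  -- already makes the kernel infinite-dimensional.
  · refine Set.eq_empty_of_forall_notMem fun ω hω => hω.1.2 ?_
    exact (Maxwell2D.mem_infinitePointSpectrum hω.2
      (Maxwell2D.eq_zero_of_mem_pointSpectrum hω.2 hω.1.1)).2
  · ext ω
    exact ⟨fun h => ⟨h.2, Maxwell2D.eq_zero_of_mem_pointSpectrum h.2 h.1.1⟩,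
      fun h => ⟨Maxwell2D.mem_infinitePointSpectrum h.1 h.2, h.1⟩⟩
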